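/- Let $\Bbbk$ be an algebraically closed field of characteristic different from $2$; varieties are classical varieties over $\Bbbk$ (spaces with sheaves of $\Bbbk$-valued functions). **Symmetric type $A$ quivers.** Let $Q$ be a quiver whose underlying graph is a path with $n\ge 1$ vertices $0,\dots,n-1$ (drawn from left to right), such that the reflection $\tau$ of the path reverses the direction of every arrow. Together with a sign $\epsilon\in\{\pm1\}$, attached to the unique vertex or arrow fixed by $\tau$, it is called a *symmetric type $A$ quiver*. Vertices and arrows in the left (right) half that are not fixed by $\tau$ are called positive (negative). $Q$ is *bipartite* if every vertex is a source or a sink. Write $ta$ and $ha$ for the tail and head of an arrow $a$. A *symmetric dimension vector* $\mathbf d$ assigns to each vertex $z$ an integer $\mathbf d(z)\ge 0$ with $\mathbf d(\tau z)=\mathbf d(z)$; if $\tau$ fixes a vertex $\star$, an invertible $\mathbf d(\star)\times \mathbf d(\star)$ matrix $\Omega$ with $\Omega^t=\epsilon\,\Omega$ is also fixed (and assumed to exist), and $K=\{g\in GL(\mathbf d(\star)) : g^t\Omega g=\Omega\}$. Put $$G(\mathbf d)=\prod_{z\ \mathrm{positive}}GL(\mathbf d(z))\times\prod_{z\ \mathrm{fixed}}K,\qquad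 \mathrm{srep}_Q(\mathbf d)=\prod_{a\ \mathrm{positive}}\mathrm{Mat}(\mathbf d(ha),\mathbf d(ta))\times\prod_{a\ \mathrm{fixed}}\mathrm{Mat}_\epsilon(\mathbf d(ha),\mathbf d(ta)),$$ where $\mathrm{Mat}_{+1}$ and $\mathrm{Mat}_{-1}$ denote symmetric and skew-symmetric matrices. The algebraic group $G(\mathbf d)$ acts on $\mathrm{srep}_Q(\mathbf d)$ by $(g\cdot V)_a=g_{ha}V_ag_{ta}^{-1}$, with $g_z:=(g_{\tau z}^{-1})^{t}$ for $z$ negative. **Homogeneous fiber bundles.** For a closed embedding of affine algebraic groups $H\hookrightarrow G$ and an affine $H$-variety $X$, let $G*_HX$ be the quotient of $G\times X$ by the action $h\cdot(g,x)=(gh^{-1},h\cdot x)$ of $H$: the orbit space with the quotient topology, where a function is regular if its pullback to $G\times X$ is regular. The group $G$ acts on it by left multiplication on the first factor. **Proposition.** Let $Q$ be a symmetric type $A$ quiver with sign $\epsilon$, and $\mathbf d$ a symmetric dimension vector for $Q$. Then there are * a bipartite symmetric type $A$ quiver $\tilde Q$ with an even number of vertices and the same sign $\epsilon$, which contracts to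 $Q$: there is an order-preserving surjection $\nu\colon\tilde Q_0\to Q_0$ on vertices that commutes with the reflections, such that for each arrow $b$ of $\tilde Q$ either $\nu(tb)=\nu(hb)$ or $Q$ has an arrow from $\nu(tb)$ to $\nu(hb)$; * the symmetric dimension vector $\tilde{\mathbf d}=\mathbf d\circ\nu$ for $\tilde Q$; * a closed embedding of algebraic groups $G(\mathbf d)\hookrightarrow G(\tilde{\mathbf d})$, given by $(g_w)_w\mapsto(g_{\nu(z)})_{z\ \mathrm{positive}}$; * a $G(\tilde{\mathbf d})$-stable open subvariety $\mathscr U\subseteq \mathrm{srep}_{\tilde Q}(\tilde{\mathbf d})$; and, with respect to this embedding, a $G(\tilde{\mathbf d})$-equivariant isomorphism of varieties $$\mathscr U\;\simeq\; G(\tilde{\mathbf d})*_{G(\mathbf d)}\mathrm{srep}_Q(\mathbf d).$$ -/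

import Mathlib

open scoped Topology

noncomputable section

namespace SymA

/-! ## Spaces with functions and classical varieties -/

/-- A space with `k`-valued functions: a topological space together with, on every open set, a class
of functions called regular, which forms a sheaf.  A function on an open set `V` is represented by
any function on the whole space; only its values on `V` matter. -/
structure FunSpace (k : Type*) (X : Type*) where
  top : TopologicalSpace X
  regular : Set X → (X → k) → Prop
  regular_mono : ∀ {V W : Set X} {f : X → k}, W ⊆ V → regular V f → regular W f
  regular_of_locally : ∀ {V : Set X} {f : X → k}, IsOpen[top] V →
    (∀ x ∈ V, ∃ W, IsOpen[top] W ∧ x ∈ W ∧ W ⊆ V ∧ ∃ g, regular W g ∧ Set.EqOn f g W) →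
    regular V f

/-- An isomorphism of spaces with functions (hence of varieties): a homeomorphism which identifies
the regular functions on corresponding open sets. -/
structure FunSpace.Iso {k X Y : Type*} (S : FunSpace k X) (T : FunSpace k Y) where
  toEquiv : X ≃ Y
  isOpen_iff : ∀ V : Set Y, IsOpen[T.top] V ↔ IsOpen[S.top] (toEquiv ⁻¹' V)
  regular_iff : ∀ V : Set Y, IsOpen[T.top] V → ∀ f : Y → k,
    T.regular V f ↔ S.regular (toEquiv ⁻¹' V) (f ∘ toEquiv)

section Constructions

variable {k : Type*} [Field k] {X Y : Type*}

/-- The Zariski topology on `X` for an algebra `A` of polynomial functions: the principal open sets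
`{h ≠ 0}`, `h ∈ A`, are a basis. -/
@[reducible] def zariski (A : Subalgebra k (X → k)) : TopologicalSpace X where
  IsOpen V := ∀ x ∈ V, ∃ h ∈ A, h x ≠ 0 ∧ ∀ y, h y ≠ 0 → y ∈ V
  isOpen_univ := fun _ _ => ⟨1, A.one_mem, by simp, by simp⟩
  isOpen_inter := by
    rintro V W hV hW x ⟨hxV, hxW⟩
    obtain ⟨h, hA, h0, hh⟩ := hV x hxV
    obtain ⟨l, lA, l0, hl⟩ := hW x hxW
    refine ⟨h * l, A.mul_mem hA lA, mul_ne_zero h0 l0, fun y hy => ?_⟩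
    exact ⟨hh y (left_ne_zero_of_mul hy), hl y (right_ne_zero_of_mul hy)⟩
  isOpen_sUnion := by
    rintro S hS x ⟨V, hV, hx⟩
    obtain ⟨h, hA, h0, hh⟩ := hS V hV x hx
    exact ⟨h, hA, h0, fun y hy => ⟨V, hV, hh y hy⟩⟩

/-- The classical affine variety with point set `X` and coordinate ring `A`: Zariski topology, and a
function is regular on `V` if near each point of `V` it is a quotient of elements of `A`. -/
def affine (A : Subalgebra k (X → k)) : FunSpace k X where
  top := zariski A
  regular V f := ∀ x ∈ V, ∃ p ∈ A, ∃ q ∈ A, q x ≠ 0 ∧ ∀ y ∈ V, q y ≠ 0 → f y = p y / q y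
  regular_mono := by
    intro V W f hWV hf x hx
    obtain ⟨p, hp, q, hq, h0, h⟩ := hf x (hWV hx)
    exact ⟨p, hp, q, hq, h0, fun y hy => h y (hWV hy)⟩
  regular_of_locally := by
    intro V f _ H x hx
    obtain ⟨W, hW, hxW, _, g, hg, hfg⟩ := H x hx
    obtain ⟨p, hp, q, hq, h0, h⟩ := hg x hxW
    obtain ⟨l, lA, l0, hl⟩ := hW x hxW
    refine ⟨p * l, A.mul_mem hp lA, q * l, A.mul_mem hq lA, mul_ne_zero h0 l0, fun y _ hy => ?_⟩
    have h1 : l y ≠ 0 := right_ne_zero_of_mul hy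
    have h2 : q y ≠ 0 := left_ne_zero_of_mul hy
    have hyW := hl y h1
    rw [hfg hyW, h y hyW h2]
    simp only [Pi.mul_apply]
    field_simp

/-- The coordinate ring of the product of two affine varieties. -/
def prodRing (A : Subalgebra k (X → k)) (B : Subalgebra k (Y → k)) : Subalgebra k (X × Y → k) :=
  Algebra.adjoin k ({f | ∃ a ∈ A, f = fun p => a p.1} ∪ {f | ∃ b ∈ B, f = fun p => b p.2})

/-- The open subspace with underlying set `U`. -/
def FunSpace.openSub (S : FunSpace k X) (U : Set X) (hU : IsOpen[S.top] U) : FunSpace k U where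
  top := S.top.induced Subtype.val
  regular V f := S.regular (Subtype.val '' V) (Function.extend Subtype.val f 0)
  regular_mono := fun hWV hf => S.regular_mono (Set.image_mono hWV) hf
  regular_of_locally := by
    let _ := S.top
    intro V f hV H
    have hemb : Topology.IsOpenEmbedding (Subtype.val : U → X) := IsOpen.isOpenEmbedding_subtypeVal hU
    refine S.regular_of_locally (hemb.isOpenMap V hV) ?_
    rintro _ ⟨x, hx, rfl⟩
    obtain ⟨W, hW, hxW, hWV, g, hg, hfg⟩ := H x hx
    refine ⟨_, hemb.isOpenMap W hW, ⟨x, hxW, rfl⟩, Set.image_mono hWV, _, hg, ?_⟩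
    rintro _ ⟨y, hy, rfl⟩
    rw [Subtype.val_injective.extend_apply, Subtype.val_injective.extend_apply, hfg hy]

/-- The quotient of a space with functions by an equivalence relation: quotient topology, and a
function is regular if its pullback is. -/
def FunSpace.quotient (S : FunSpace k X) (r : Setoid X) : FunSpace k (Quotient r) where
  top := S.top.coinduced (Quotient.mk r)
  regular V f := S.regular (Quotient.mk r ⁻¹' V) (f ∘ Quotient.mk r)
  regular_mono := fun hWV hf => S.regular_mono (Set.preimage_mono hWV) hf
  regular_of_locally := by
    intro V f hV H
    refine S.regular_of_locally hV fun x hx => ?_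
    obtain ⟨W, hW, hxW, hWV, g, hg, hfg⟩ := H _ hx
    exact ⟨_, hW, hxW, Set.preimage_mono hWV, _, hg, fun y hy => hfg hy⟩

/-- `ι : H → G` is a closed embedding of affine algebraic groups with coordinate rings `A` and `B`:
an injective homomorphism with Zariski closed image, for which the regular functions on `H` are
exactly the restrictions of those on `G`. -/
def IsClosedEmbedding {H G : Type*} [Group H] [Group G] (A : Subalgebra k (H → k))
    (B : Subalgebra k (G → k)) (ι : H →* G) : Prop :=
  Function.Injective ι ∧ IsClosed[zariski B] (Set.range ι) ∧
    ∀ f : H → k, f ∈ A ↔ ∃ F ∈ B, f = F ∘ ι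

end Constructions

/-! ## Homogeneous fiber bundles -/

section Bundle

variable {H G : Type*} [Group H] [Group G] (ι : H →* G) (X : Type*) [MulAction H X]

/-- The orbit relation of the action `h • (g, x) = (g h⁻¹, h • x)` of `H` on `G × X`, where `H` is
viewed inside `G` through `ι`. -/
def bundleSetoid : Setoid (G × X) where
  r p q := ∃ h : H, q = (p.1 * (ι h)⁻¹, h • p.2)
  iseqv :=
    { refl := fun p => ⟨1, by simp⟩
      symm := by
        rintro p q ⟨h, rfl⟩
        exact ⟨h⁻¹, by simp⟩
      trans := by
        rintro p q r ⟨h, rfl⟩ ⟨l, rfl⟩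
        exact ⟨l * h, by simp [mul_assoc, mul_smul]⟩ }

/-- The homogeneous fiber bundle `G *_H X`, as a set. -/
def Bundle : Type _ := Quotient (bundleSetoid ι X)

/-- `G` acts on `G *_H X` by left multiplication on the first factor. -/
instance : MulAction G (Bundle ι X) where
  smul g := Quotient.map (fun p => (g * p.1, p.2)) (by
    rintro p q ⟨h, rfl⟩
    exact ⟨h, by simp [mul_assoc]⟩)
  one_smul := by
    rintro ⟨p⟩
    exact congrArg (Quotient.mk _) (by simp)
  mul_smul := by
    rintro g g' ⟨p⟩
    exact congrArg (Quotient.mk _) (by simp [mul_assoc])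

/-- The geometry of `G *_H X`, for affine `G` and `X` with coordinate rings `B` and `C`: it is the
quotient of the variety `G × X`. -/
def bundleSpace {k : Type*} [Field k] (B : Subalgebra k (G → k)) (C : Subalgebra k (X → k)) :
    FunSpace k (Bundle ι X) :=
  (affine (prodRing B C)).quotient (bundleSetoid ι X)

end Bundle

/-! ## Symmetric quivers of type A -/

/-- A symmetric quiver of Dynkin type A.  The vertices are `0, …, m` and for each `i < m` there is
one arrow `i` joining the vertices `i` and `i + 1`; it points from `i` to `i + 1` if `right i` holds,
and from `i + 1` to `i` otherwise.  The involution `τ` is the reflection `Fin.rev` on vertices and on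
arrows; `right_rev` says that it reverses orientation.  `sign` is the value of the sign function on
the unique fixed vertex or arrow. -/
structure SymQuiver where
  m : ℕ
  right : Fin m → Bool
  right_rev : ∀ a, right a.rev = right a
  sign : ℤˣ

namespace SymQuiver

variable (Q : SymQuiver)

/-- The vertices. -/
abbrev V : Type := Fin (Q.m + 1)

/-- The tail of an arrow. -/
def tail (a : Fin Q.m) : Q.V := if Q.right a then a.castSucc else a.succ

/-- The head of an arrow. -/
def head (a : Fin Q.m) : Q.V := if Q.right a then a.succ else a.castSucc

/-- The positive and the fixed arrows: those in the left half, including the middle one. -/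
abbrev Arrow : Type := {a : Fin Q.m // a ≤ a.rev}

/-- Every vertex is a sink or a source. -/
def IsBipartite : Prop := ∀ z : Q.V, (∀ a, Q.tail a ≠ z) ∨ (∀ a, Q.head a ≠ z)

theorem head_rev (a : Fin Q.m) : Q.head a.rev = (Q.tail a).rev := by
  unfold head tail
  rw [Q.right_rev]
  split
  · exact (Fin.rev_castSucc a).symm
  · exact (Fin.rev_succ a).symm

theorem head_eq_of_fixed {a : Fin Q.m} (ha : a.rev = a) : Q.head a = (Q.tail a).rev := by
  rw [← Q.head_rev, ha]

end SymQuiver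

/-- `Q` is a contraction of `Q'`: a surjection `ν` on vertices which preserves the linear order and
the involution, such that each arrow of `Q'` either is contracted to a vertex or becomes an arrow of
`Q` in the same direction; the signs agree. -/
structure Contraction (Q' Q : SymQuiver) where
  ν : Q'.V → Q.V
  monotone : Monotone ν
  surjective : Function.Surjective ν
  map_rev : ∀ z, ν z.rev = (ν z).rev
  map_arrow : ∀ b, ν (Q'.tail b) = ν (Q'.head b) ∨
    ∃ a, Q.tail a = ν (Q'.tail b) ∧ Q.head a = ν (Q'.head b)
  sign_eq : Q'.sign = Q.sign

/-- A symmetric dimension vector, with the nondegenerate bilinear form `Ω` chosen at the vertex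
fixed by `τ`, if there is one; `Ω` is symmetric or skew-symmetric according to the sign. -/
structure SymDim (k : Type*) [Field k] (Q : SymQuiver) where
  dim : Q.V → ℕ
  dim_rev : ∀ z, dim z.rev = dim z
  Ω : ∀ z : Q.V, z.rev = z → Matrix (Fin (dim z)) (Fin (dim z)) k
  isUnit_Ω : ∀ z hz, IsUnit (Ω z hz)
  Ω_transpose : ∀ z hz, (Ω z hz).transpose = ((Q.sign : ℤ) : k) • Ω z hz

/-- The inverse transpose `g ↦ g⁻ᵗ` of an invertible matrix, along an equality of sizes. -/
def contra {k : Type*} [Field k] {a b : ℕ} (h : b = a) : GL (Fin a) k →* GL (Fin b) k where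
  toFun g :=
    { val := (g⁻¹).val.transpose.submatrix (finCongr h) (finCongr h)
      inv := g.val.transpose.submatrix (finCongr h) (finCongr h)
      val_inv := by
        rw [Matrix.submatrix_mul_equiv, ← Matrix.transpose_mul, Units.mul_inv]; simp
      inv_val := by
        rw [Matrix.submatrix_mul_equiv, ← Matrix.transpose_mul, Units.inv_mul]; simp }
  map_one' := by
    apply Units.ext
    simp
  map_mul' g g' := by
    apply Units.ext
    simp only [Units.val_mul, mul_inv_rev, Matrix.transpose_mul]
    rw [Matrix.submatrix_mul_equiv]

namespace SymDim

variable {k : Type*} [Field k] {Q : SymQuiver} (d : SymDim k Q)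

/-- The base change group `G(d)`, as a subgroup of `GL(d) = ∏ GL(d z)`: at the fixed vertex the
component preserves `Ω`, and the component at `τ z ≠ z` is the inverse transpose of that at `z`.  So
the components at the positive vertices and in `K` at the fixed vertex determine the element and
are arbitrary. -/
def G : Subgroup (∀ z : Q.V, GL (Fin (d.dim z)) k) where
  carrier := {g | (∀ z, z.rev ≠ z → g z.rev = contra (d.dim_rev z) (g z)) ∧
    ∀ z hz, (g z).val.transpose * d.Ω z hz * (g z).val = d.Ω z hz}
  one_mem' := by simp
  mul_mem' := by
    rintro g h ⟨hg, hg'⟩ ⟨hh, hh'⟩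
    refine ⟨fun z hz => by simp [hg z hz, hh z hz], fun z hz => ?_⟩
    calc _ = (h z).val.transpose * ((g z).val.transpose * d.Ω z hz * (g z).val) * (h z).val := by
          simp [Matrix.transpose_mul, Matrix.mul_assoc]
      _ = _ := by rw [hg' z hz, hh' z hz]
  inv_mem' := by
    rintro g ⟨hg, hg'⟩
    refine ⟨fun z hz => by simp [hg z hz], fun z hz => ?_⟩
    have h1 : (g z).val * (g z)⁻¹.val = 1 := Units.mul_inv _
    have h2 : (g z)⁻¹.val.transpose * (g z).val.transpose = 1 := by
      rw [← Matrix.transpose_mul, h1, Matrix.transpose_one]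
    calc (g z)⁻¹.val.transpose * d.Ω z hz * (g z)⁻¹.val
        = (g z)⁻¹.val.transpose * ((g z).val.transpose * d.Ω z hz * (g z).val) * (g z)⁻¹.val := by
          rw [hg' z hz]
      _ = ((g z)⁻¹.val.transpose * (g z).val.transpose) * d.Ω z hz *
            ((g z).val * (g z)⁻¹.val) := by simp only [Matrix.mul_assoc]
      _ = d.Ω z hz := by rw [h1, h2]; simp

theorem dim_head {a : Fin Q.m} (ha : a.rev = a) : d.dim (Q.head a) = d.dim (Q.tail a) := by
  rw [Q.head_eq_of_fixed ha, d.dim_rev]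

/-- Families of matrices, one for each positive or fixed arrow. -/
abbrev Family : Type _ :=
  ∀ a : Q.Arrow, Matrix (Fin (d.dim (Q.head a.1))) (Fin (d.dim (Q.tail a.1))) k

/-- The symmetric representation space: arbitrary matrices at the positive arrows and a symmetric or
skew-symmetric one, according to the sign, at the fixed arrow. -/
def srep : Submodule k d.Family where
  carrier := {W | ∀ (a : Q.Arrow) (ha : a.1.rev = a.1), ∀ i j,
    W a i j = ((Q.sign : ℤ) : k) *
      W a (Fin.cast (d.dim_head ha).symm j) (Fin.cast (d.dim_head ha) i)}
  zero_mem' := by intro a ha i j; simp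
  add_mem' := by
    intro x y hx hy a ha i j
    simp only [Pi.add_apply, Matrix.add_apply]
    rw [hx a ha i j, hy a ha i j]; ring
  smul_mem' := by
    intro c x hx a ha i j
    simp only [Pi.smul_apply, Matrix.smul_apply, smul_eq_mul]
    rw [hx a ha i j]; ring

variable {d}

theorem G_apply_of_eq (g : d.G) {w z : Q.V} (h : w = z.rev) (hz : z.rev ≠ z)
    (hd : d.dim w = d.dim z) (i j) :
    (g.1 w).val i j = ((g.1 z)⁻¹).val (Fin.cast hd j) (Fin.cast hd i) := by
  subst h
  rw [g.2.1 z hz]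
  rfl

theorem tail_not_fixed {a : Fin Q.m} (ha : a.rev = a) : (Q.tail a).rev ≠ Q.tail a := by
  rw [← Q.head_eq_of_fixed ha]
  unfold SymQuiver.head SymQuiver.tail
  intro h
  have := congrArg Fin.val h
  split at this <;> simp at this

theorem smul_mem (g : d.G) {W : d.Family} (hW : W ∈ d.srep) :
    (fun a => (g.1 (Q.head a.1)).val * W a * ((g.1 (Q.tail a.1))⁻¹).val : d.Family) ∈ d.srep := by
  intro a ha i j
  have hd := d.dim_head ha
  have key := G_apply_of_eq g (Q.head_eq_of_fixed ha) (tail_not_fixed ha) hd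
  simp only [Matrix.mul_apply, Finset.sum_mul, Finset.mul_sum]
  rw [Finset.sum_comm, ← Equiv.sum_comp (finCongr hd)]
  refine Finset.sum_congr rfl fun p _ => ?_
  rw [← Equiv.sum_comp (finCongr hd).symm]
  refine Finset.sum_congr rfl fun q _ => ?_
  rw [key, key, hW a ha p q]
  simp
  ring

/-- The action `(g W)_a = g_{ha} W_a g_{ta}⁻¹` of `G(d)` on the symmetric representation space. -/
instance : MulAction d.G d.srep where
  smul g W := ⟨_, smul_mem g W.2⟩
  one_smul W := by
    apply Subtype.ext
    funext a
    change (1 : Matrix _ _ k) * W.1 a * ((1 : GL (Fin (d.dim (Q.tail a.1))) k)⁻¹).val = W.1 a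
    simp
  mul_smul g h W := by
    apply Subtype.ext
    funext a
    change (g.1 (Q.head a.1) * h.1 (Q.head a.1)).val * W.1 a *
        ((g.1 (Q.tail a.1) * h.1 (Q.tail a.1))⁻¹).val =
      (g.1 (Q.head a.1)).val * ((h.1 (Q.head a.1)).val * W.1 a *
        ((h.1 (Q.tail a.1))⁻¹).val) * ((g.1 (Q.tail a.1))⁻¹).val
    simp only [Units.val_mul, mul_inv_rev, Matrix.mul_assoc]

variable (d)

/-- The coordinate ring of `G(d)`, generated by the entries of all `g_z` and `g_z⁻¹`. -/
def groupRing : Subalgebra k (d.G → k) :=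
  Algebra.adjoin k ({f | ∃ z i j, f = fun g => (g.1 z).val i j} ∪
    {f | ∃ z i j, f = fun g => ((g.1 z)⁻¹).val i j})

/-- The coordinate ring of the symmetric representation space, generated by the matrix entries. -/
def srepRing : Subalgebra k (d.srep → k) :=
  Algebra.adjoin k {f | ∃ a i j, f = fun W => W.1 a i j}

end SymDim

/-- `ι : G(d) → G(d')` is the pullback `(g_w) ↦ (g_{ν z})` along a contraction `ν`, for dimension
vectors with `d' = d ∘ ν`.  The formula is imposed at the positive and fixed vertices of `Q'`, whose
components determine an element of `G(d')`. -/
def IsPullback {k : Type*} [Field k] {Q' Q : SymQuiver} {d' : SymDim k Q'} {d : SymDim k Q}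
    (c : Contraction Q' Q) (hd : ∀ z, d'.dim z = d.dim (c.ν z)) (ι : d.G →* d'.G) : Prop :=
  ∀ (g : d.G) (z : Q'.V), z ≤ z.rev → ∀ i j,
    ((ι g).1 z).val i j = (g.1 (c.ν z)).val (Fin.cast (hd z) i) (Fin.cast (hd z) j)

end SymA

end

noncomputable section

namespace SymA

/-! Double every arrow of `Q` and let the orientations alternate. Of the two copies of an arrow one
has its direction and carries it; the other is contracted. If `Q` has a fixed vertex, the middle
arrow of the new quiver lies over it and is contracted too. A representation of `Q` extends to the
new quiver by the identity at the contracted arrows off the middle and by `Ω⁻¹` at a contracted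
middle arrow; these extensions form the slice, and `𝒰` is its saturation under the big group.

An element taking a point of the slice into the slice preserves the standard values. So it has equal
components at the two ends of each contracted arrow off the middle, and its component `x` at the
head of a contracted middle arrow satisfies `x Ω⁻¹ xᵀ = Ω⁻¹`, that is `xᵀ Ω x = Ω`. Hence it comes
from `G(d)` (`mem_range_of_smul_slice`), and `G(d̃) *_{G(d)} srep_Q(d) → 𝒰` is an equivariant
bijection.

For an isomorphism of varieties one needs local sections of `(g, V) ↦ g • slice V`. Once the
matrices `W_b` at the contracted arrows are invertible, the equations `g_t = W_b⁻¹ g_h` are solved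
by regular functions, but bringing the middle matrix to the form `γ Ω⁻¹ γᵀ` needs square roots. It
is therefore done on towers of double covers `t² = a`, `a ≠ 0` (`exists_cover_sqrt`,
`exists_cover_congruent`). Since the characteristic is not `2`, comparing the values at `t` and `-t`
shows that regular functions descend along such covers (`descends_sqrt`), hence along the action
map, through which the cover factors (`exists_descends`). The criterion `exists_bundleIso` turns
descent into openness of `𝒰` and the isomorphism. -/

/-! ## Descent of regular functions along a map -/

section Descent

variable {k : Type*} [Field k]

/-- Regular functions descend along `p : E → X` near `e₀`: whenever a quotient `P / Q` of regular
functions on `E` with `Q e₀ ≠ 0` is constant on the fibres of `p`, its value is a quotient of regular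
functions on `X`, near `p e₀`. -/
def Descends {X E : Type*} (A : Subalgebra k (X → k)) (B : Subalgebra k (E → k)) (p : E → X)
    (e₀ : E) : Prop :=
  ∀ P ∈ B, ∀ Q ∈ B, Q e₀ ≠ 0 → ∃ r ∈ A, ∃ q ∈ A, q (p e₀) ≠ 0 ∧
    ∀ x c, (∀ e, p e = x → c * Q e = P e) → c * q x = r x

variable {X E F : Type*} {A : Subalgebra k (X → k)} {B : Subalgebra k (E → k)}
  {C : Subalgebra k (F → k)}

theorem Descends.comp {p : E → X} {s : F → E} {e₀ : E} {f₀ : F} (h : Descends A B p e₀)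
    (hs : s f₀ = e₀) (h' : Descends B C s f₀) : Descends A C (p ∘ s) f₀ := by
  subst hs
  intro P hP Q hQ hQ0
  obtain ⟨r, hr, q, hq, hq0, H⟩ := h' P hP Q hQ hQ0
  obtain ⟨r', hr', q', hq', hq0', H'⟩ := h r hr q hq hq0
  refine ⟨r', hr', q', hq', hq0', fun x c hx => H' x c fun e he => H e c fun f hf => hx f ?_⟩
  simp [hf, he]

/-- If descent holds for a map which lifts to `E`, it holds for `p`. -/
theorem Descends.of_lift {p : E → X} {s : F → E} {f₀ : F} (h : Descends A C (p ∘ s) f₀)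
    (hs : ∀ b ∈ B, b ∘ s ∈ C) : Descends A B p (s f₀) := by
  intro P hP Q hQ hQ0
  obtain ⟨r, hr, q, hq, hq0, H⟩ := h _ (hs P hP) _ (hs Q hQ) hQ0
  exact ⟨r, hr, q, hq, hq0, fun x c hx => H x c fun f hf => hx _ hf⟩

/-- Near the chosen point, every fibre contains a point at which `Q` does not vanish. -/
theorem Descends.exists_nonvanishing {p : E → X} {e₀ : E} (h : Descends A B p e₀) {Q : E → k}
    (hQ : Q ∈ B) (hQ0 : Q e₀ ≠ 0) :
    ∃ q ∈ A, q (p e₀) ≠ 0 ∧ ∀ x, q x ≠ 0 → ∃ e, p e = x ∧ Q e ≠ 0 := by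
  -- Descend `0 / Q`. If `Q` vanishes on the whole fibre over `x`, in particular if the fibre is
  -- empty, both `c = 0` and `c = 1` satisfy the fibre condition, which forces `q x = 0`. So descent
  -- contains openness.
  obtain ⟨r, -, q, hq, hq0, H⟩ := h 0 B.zero_mem Q hQ hQ0
  refine ⟨q, hq, hq0, fun x hx => ?_⟩
  by_contra! hc
  have h0 := H x 0 (fun e _ => by simp)
  have h1 := H x 1 (fun e he => by simp [hc e he])
  apply hx
  rw [← one_mul (q x), h1, ← h0, zero_mul]

end Descent

/-! ## Recognition of homogeneous fiber bundles -/

section Recognition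

variable {k : Type*} [Field k] {H G X Y : Type*} [Group H] [Group G] [MulAction H Y]
  [MulAction G X] (ι : H →* G) (σ : Y → X)

/-- The `G`-saturation of the image of `σ`. -/
def saturation (G : Type*) [Group G] [MulAction G X] (σ : Y → X) : SubMulAction G X where
  carrier := Set.range fun p : G × Y => p.1 • σ p.2
  smul_mem' := by
    rintro g _ ⟨p, rfl⟩
    exact ⟨(g * p.1, p.2), mul_smul _ _ _⟩

variable {ι σ}

/-- `hstab` produces the element of `H` that relates the group components; equivariance and
injectivity of `σ` then identify the points of `Y`. -/
theorem fiber_eq (hσ : ∀ (h : H) y, σ (h • y) = ι h • σ y) (hinj : Function.Injective σ)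
    (hstab : ∀ (g : G) y y', g • σ y = σ y' → g ∈ ι.range) (p q : G × Y) :
    p.1 • σ p.2 = q.1 • σ q.2 ↔ bundleSetoid ι Y p q := by
  constructor
  · intro h
    have h1 : (q.1⁻¹ * p.1) • σ p.2 = σ q.2 := by rw [mul_smul, h, inv_smul_smul]
    obtain ⟨l, hl⟩ := hstab _ _ _ h1
    refine ⟨l, Prod.ext ?_ ?_⟩
    · simp [hl]
    · apply hinj
      rw [hσ, hl, h1]
  · rintro ⟨l, rfl⟩
    simp [hσ, mul_smul]

/-- The bijection from `G *_H Y` to the saturation of `Y`. -/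
def bundleEquiv (hσ : ∀ (h : H) y, σ (h • y) = ι h • σ y) (hinj : Function.Injective σ)
    (hstab : ∀ (g : G) y y', g • σ y = σ y' → g ∈ ι.range) :
    Bundle ι Y ≃ saturation G σ :=
  Equiv.ofBijective
    (Quotient.lift (fun p : G × Y => (⟨p.1 • σ p.2, p, rfl⟩ : saturation G σ))
      fun p q h => Subtype.ext ((fiber_eq hσ hinj hstab p q).2 h))
    (by
      constructor
      · rintro ⟨p⟩ ⟨q⟩ h
        exact Quotient.sound ((fiber_eq hσ hinj hstab p q).1 (congrArg Subtype.val h))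
      · rintro ⟨_, p, rfl⟩
        exact ⟨Quotient.mk _ p, rfl⟩)

variable {A : Subalgebra k (X → k)} {B : Subalgebra k (G → k)} {C : Subalgebra k (Y → k)}

/-- Non-vanishing of the constant function `1` somewhere on a fibre just says that the fibre is
nonempty. -/
theorem isOpen_saturation
    (hdesc : ∀ u ∈ saturation G σ, ∃ e : G × Y, e.1 • σ e.2 = u ∧
      Descends A (prodRing B C) (fun p : G × Y => p.1 • σ p.2) e) :
    IsOpen[zariski A] (saturation G σ : Set X) := by
  intro u hu
  obtain ⟨e, rfl, he⟩ := hdesc u hu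
  obtain ⟨q, hq, hq0, H⟩ := he.exists_nonvanishing (Subalgebra.one_mem _) one_ne_zero
  exact ⟨q, hq, hq0, fun x hx => (H x hx).imp fun e h => h.1⟩

/-- Recognition principle: if regular functions descend along `(g, y) ↦ g • σ y`, the saturation
of `Y` is the homogeneous fiber bundle. -/
theorem exists_bundleIso (hσ : ∀ (h : H) y, σ (h • y) = ι h • σ y) (hinj : Function.Injective σ)
    (hstab : ∀ (g : G) y y', g • σ y = σ y' → g ∈ ι.range)
    (hreg : ∀ a ∈ A, (fun p : G × Y => a (p.1 • σ p.2)) ∈ prodRing B C)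
    (hdesc : ∀ u ∈ saturation G σ, ∃ e : G × Y, e.1 • σ e.2 = u ∧
      Descends A (prodRing B C) (fun p : G × Y => p.1 • σ p.2) e) :
    ∃ φ : FunSpace.Iso
        ((affine A).openSub (saturation G σ : Set X) (isOpen_saturation hdesc))
        (bundleSpace ι Y B C),
      ∀ (g : G) (u : saturation G σ), φ.toEquiv (g • u) = g • φ.toEquiv u := by
  set Φ := bundleEquiv hσ hinj hstab with hΦ
  have hmem : ∀ p : G × Y, p.1 • σ p.2 ∈ saturation G σ := fun p => ⟨p, rfl⟩
  have hmk : ∀ p : G × Y, Φ.symm ⟨p.1 • σ p.2, hmem p⟩ = Quotient.mk (bundleSetoid ι Y) p :=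
    fun p => (Equiv.symm_apply_eq _).2 rfl
  have hpre : ∀ (V : Set (Bundle ι Y)) (p : G × Y),
      p.1 • σ p.2 ∈ Subtype.val '' (Φ.symm ⁻¹' V) ↔ Quotient.mk (bundleSetoid ι Y) p ∈ V := by
    intro V p
    rw [← hmk p]
    constructor
    · rintro ⟨u, hu, he⟩
      have : u = ⟨p.1 • σ p.2, hmem p⟩ := Subtype.ext he
      rwa [this] at hu
    · intro h
      exact ⟨_, h, rfl⟩
  have hopen := isOpen_saturation hdesc
  refine ⟨⟨Φ.symm, ?_, ?_⟩, ?_⟩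
  · intro V
    let _ := zariski A
    have hemb := IsOpen.isOpenEmbedding_subtypeVal hopen
    refine Iff.trans ?_ (hemb.isOpen_iff_image_isOpen (s := Φ.symm ⁻¹' V)).symm
    change IsOpen[zariski (prodRing B C)] (Quotient.mk (bundleSetoid ι Y) ⁻¹' V) ↔ _
    constructor
    -- The principal neighbourhood `{f ≠ 0}` need not be saturated: it suffices that every fibre
    -- over `{q ≠ 0}` meets it.
    · rintro hV x ⟨u, hu, rfl⟩
      obtain ⟨e, he, hd⟩ := hdesc u.1 u.2
      have heV : Quotient.mk (bundleSetoid ι Y) e ∈ V := by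
        rw [← hpre, he]
        exact ⟨u, hu, rfl⟩
      obtain ⟨f, hf, hf0, hfV⟩ := hV e heV
      obtain ⟨q, hq, hq0, hqV⟩ := hd.exists_nonvanishing hf hf0
      refine ⟨q, hq, by simpa [he] using hq0, fun x hx => ?_⟩
      obtain ⟨e', rfl, he'⟩ := hqV x hx
      exact (hpre V e').2 (hfV e' he')
    · intro hV p hp
      obtain ⟨a, ha, ha0, haV⟩ := hV _ ((hpre V p).2 hp)
      exact ⟨_, hreg a ha, ha0, fun e he => (hpre V e).1 (haV _ he)⟩
  · intro V hV f
    set f' : X → k := Function.extend Subtype.val (f ∘ Φ.symm) 0 with hf'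
    have hval : ∀ p : G × Y, f' (p.1 • σ p.2) = f (Quotient.mk (bundleSetoid ι Y) p) := by
      intro p
      have := Subtype.val_injective.extend_apply (f ∘ Φ.symm) 0
        (⟨p.1 • σ p.2, hmem p⟩ : saturation G σ)
      rw [hf', this, Function.comp_apply, hmk]
    change (∀ x ∈ Quotient.mk (bundleSetoid ι Y) ⁻¹' V, ∃ p ∈ prodRing B C, ∃ q ∈ prodRing B C,
      q x ≠ 0 ∧ ∀ y ∈ Quotient.mk (bundleSetoid ι Y) ⁻¹' V, q y ≠ 0 → f (Quotient.mk _ y) = p y / q y) ↔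
      ∀ x ∈ Subtype.val '' (Φ.symm ⁻¹' V), ∃ p ∈ A, ∃ q ∈ A,
        q x ≠ 0 ∧ ∀ y ∈ Subtype.val '' (Φ.symm ⁻¹' V), q y ≠ 0 → f' y = p y / q y
    constructor
    · rintro h _ ⟨u, hu, rfl⟩
      obtain ⟨e, he, hd⟩ := hdesc u.1 u.2
      have heV : Quotient.mk (bundleSetoid ι Y) e ∈ V := by
        rw [← hpre, he]
        exact ⟨u, hu, rfl⟩
      obtain ⟨P, hP, Q, hQ, hQ0, hPQ⟩ := h e heV
      -- `P Q / Q²` replaces `P / Q`: the fibre condition is required at all points of the fibre,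
      -- and where `Q` vanishes nothing is known about `P`, whereas `P Q` and `Q²` both vanish.
      obtain ⟨r, hr, q, hq, hq0, hrq⟩ := hd (P * Q) (mul_mem hP hQ) (Q * Q) (mul_mem hQ hQ)
        (mul_ne_zero hQ0 hQ0)
      refine ⟨r, hr, q, hq, by simpa [he] using hq0, fun y hy hqy => ?_⟩
      rw [eq_div_iff hqy]
      refine hrq y _ fun e' he' => ?_
      subst he'
      by_cases h0 : Q e' = 0
      · simp [h0]
      · rw [hval, hPQ e' ((hpre V e').1 hy) h0]
        simp only [Pi.mul_apply]
        field_simp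
    · intro h p hp
      obtain ⟨r, hr, q, hq, hq0, hrq⟩ := h _ ((hpre V p).2 hp)
      refine ⟨_, hreg r hr, _, hreg q hq, hq0, fun e he hqe => ?_⟩
      rw [← hval]
      exact hrq _ ((hpre V e).2 he) hqe
  · rintro g ⟨_, p, rfl⟩
    have h1 := hmk p
    have h2 := hmk (g * p.1, p.2)
    change Φ.symm ⟨g • p.1 • σ p.2, _⟩ = g • Φ.symm ⟨p.1 • σ p.2, _⟩
    rw [h1]
    refine Eq.trans ?_ h2
    congr 1
    apply Subtype.ext
    simp [mul_smul]

end Recognition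

/-! ## Matrices of regular functions -/

section Regular

variable {k : Type*} [Field k] {X E : Type*} (A : Subalgebra k (X → k)) {l m n o : Type*}

/-- A matrix-valued function whose entries are regular. -/
def RegMatrix (M : X → Matrix m n k) : Prop := ∀ i j, (fun x => M x i j) ∈ A

variable {A}

theorem const_mem (A : Subalgebra k (X → k)) (c : k) : (fun _ => c) ∈ A := A.algebraMap_mem c

theorem sum_fun_mem {s : Finset l} {f : l → X → k} (h : ∀ i ∈ s, f i ∈ A) :
    (fun x => ∑ i ∈ s, f i x) ∈ A := by
  have : (fun x => ∑ i ∈ s, f i x) = ∑ i ∈ s, f i := by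
    funext x
    simp
  rw [this]
  exact sum_mem h

theorem prod_fun_mem {s : Finset l} {f : l → X → k} (h : ∀ i ∈ s, f i ∈ A) :
    (fun x => ∏ i ∈ s, f i x) ∈ A := by
  have : (fun x => ∏ i ∈ s, f i x) = ∏ i ∈ s, f i := by
    funext x
    simp
  rw [this]
  exact prod_mem h

namespace RegMatrix

theorem const (M : Matrix m n k) : RegMatrix A (fun _ => M) := fun _ _ => const_mem A _

theorem mul [Fintype m] {M : X → Matrix l m k} {N : X → Matrix m n k} (hM : RegMatrix A M)
    (hN : RegMatrix A N) : RegMatrix A (fun x => M x * N x) := by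
  intro i j
  simp only [Matrix.mul_apply]
  exact sum_fun_mem fun p _ => A.mul_mem (hM i p) (hN p j)

theorem transpose {M : X → Matrix m n k} (hM : RegMatrix A M) :
    RegMatrix A (fun x => (M x).transpose) := fun i j => hM j i

theorem submatrix {M : X → Matrix m n k} (hM : RegMatrix A M) (f : l → m) (g : o → n) :
    RegMatrix A (fun x => (M x).submatrix f g) := fun i j => hM (f i) (g j)

theorem smul {a : X → k} (ha : a ∈ A) {M : X → Matrix m n k} (hM : RegMatrix A M) :
    RegMatrix A (fun x => a x • M x) := fun i j => A.mul_mem ha (hM i j)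

theorem neg {M : X → Matrix m n k} (hM : RegMatrix A M) :
    RegMatrix A (fun x => - M x) := fun i j => neg_mem (hM i j)

theorem sub {M N : X → Matrix m n k} (hM : RegMatrix A M) (hN : RegMatrix A N) :
    RegMatrix A (fun x => M x - N x) := fun i j => sub_mem (hM i j) (hN i j)

theorem fromBlocks {M : X → Matrix m n k} {N : X → Matrix m o k} {M' : X → Matrix l n k}
    {N' : X → Matrix l o k} (hM : RegMatrix A M) (hN : RegMatrix A N) (hM' : RegMatrix A M')
    (hN' : RegMatrix A N') :
    RegMatrix A (fun x => Matrix.fromBlocks (M x) (N x) (M' x) (N' x)) := by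
  rintro (i | i) (j | j)
  exacts [hM i j, hN i j, hM' i j, hN' i j]

theorem comp {B : Subalgebra k (E → k)} {p : E → X} (hp : ∀ a ∈ A, a ∘ p ∈ B)
    {M : X → Matrix m n k} (hM : RegMatrix A M) : RegMatrix B (fun e => M (p e)) :=
  fun i j => hp _ (hM i j)

theorem det [Fintype n] [DecidableEq n] {M : X → Matrix n n k} (hM : RegMatrix A M) :
    (fun x => (M x).det) ∈ A := by
  simp only [Matrix.det_apply']
  exact sum_fun_mem fun τ _ => A.mul_mem (const_mem A _) (prod_fun_mem fun i _ => hM (τ i) i)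

theorem adjugate [Fintype n] [DecidableEq n] {M : X → Matrix n n k} (hM : RegMatrix A M) :
    RegMatrix A (fun x => (M x).adjugate) := by
  intro i j
  simp only [Matrix.adjugate_apply]
  refine det fun p q => ?_
  by_cases h : p = j
  · subst h
    simpa using const_mem A _
  · simpa [h] using hM p q

theorem inv [Fintype n] [DecidableEq n] {M : X → Matrix n n k} (hM : RegMatrix A M)
    (h : (fun x => ((M x).det)⁻¹) ∈ A) : RegMatrix A (fun x => (M x)⁻¹) := by
  simp only [Matrix.inv_def, Ring.inverse_eq_inv']
  exact smul h hM.adjugate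

end RegMatrix

variable (A) in
/-- A function with values in an open general linear group which is regular together with its
inverse. -/
def RegGL [Fintype n] [DecidableEq n] (g : X → GL n k) : Prop :=
  RegMatrix A (fun x => (g x).val) ∧ RegMatrix A (fun x => ((g x)⁻¹).val)

namespace RegGL

variable [Fintype n] [DecidableEq n]

theorem const (g : GL n k) : RegGL A (fun _ => g) := ⟨RegMatrix.const _, RegMatrix.const _⟩

theorem mul {g h : X → GL n k} (hg : RegGL A g) (hh : RegGL A h) :
    RegGL A (fun x => g x * h x) := by
  refine ⟨hg.1.mul hh.1, ?_⟩
  simpa using hh.2.mul hg.2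

theorem inv {g : X → GL n k} (hg : RegGL A g) : RegGL A (fun x => (g x)⁻¹) := by
  refine ⟨hg.2, ?_⟩
  simpa using hg.1

theorem comp {B : Subalgebra k (E → k)} {p : E → X} (hp : ∀ a ∈ A, a ∘ p ∈ B)
    {g : X → GL n k} (hg : RegGL A g) : RegGL B (fun e => g (p e)) :=
  ⟨hg.1.comp hp, hg.2.comp hp⟩

end RegGL

end Regular

/-! ## Covers along which regular functions descend -/

section Cover

universe u
variable {k : Type u} [Field k]

/-- A map to `X` along which regular functions descend near a chosen preimage of `x₀`. -/
structure Cover {X : Type u} (A : Subalgebra k (X → k)) (x₀ : X) where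
  E : Type u
  B : Subalgebra k (E → k)
  p : E → X
  e₀ : E
  map_base : p e₀ = x₀
  comap_mem : ∀ a ∈ A, a ∘ p ∈ B
  descends : Descends A B p e₀

namespace Cover

variable {X : Type u} {A : Subalgebra k (X → k)} {x₀ : X}

variable (A x₀) in
/-- The identity. -/
def refl : Cover A x₀ where
  E := X
  B := A
  p := id
  e₀ := x₀
  map_base := rfl
  comap_mem := fun _ h => h
  descends := fun P hP Q hQ hQ0 => ⟨P, hP, Q, hQ, hQ0, fun x _ h => h x rfl⟩

/-- A cover of a cover. -/
def comp (c : Cover A x₀) (c' : Cover c.B c.e₀) : Cover A x₀ where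
  E := c'.E
  B := c'.B
  p := c.p ∘ c'.p
  e₀ := c'.e₀
  map_base := by simp [c'.map_base, c.map_base]
  comap_mem := fun a ha => c'.comap_mem _ (c.comap_mem a ha)
  descends := c.descends.comp c'.map_base c'.descends

end Cover

/-- Pairs of a point `x` and an invertible square root of `a x`. -/
abbrev SqrtPoints {X : Type u} (a : X → k) : Type u := {q : X × k // q.2 ≠ 0 ∧ q.2 * q.2 = a q.1}

/-- The coordinate ring of the double cover defined by an invertible square root of `a`. -/
def sqrtRing {X : Type u} (A : Subalgebra k (X → k)) (a : X → k) :
    Subalgebra k (SqrtPoints a → k) :=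
  Algebra.adjoin k ({f | ∃ b ∈ A, f = fun e => b e.1.1} ∪
    {(fun e => e.1.2), (fun e => e.1.2⁻¹)})

/-- Since `t² = a` and `t⁻¹ a = t`, a power of `a` clears the inverses of `t`, and what remains is
linear in `t`. -/
theorem sqrtRing_normal_form {X : Type u} {A : Subalgebra k (X → k)} {a : X → k} (ha : a ∈ A)
    {f : SqrtPoints a → k} (hf : f ∈ sqrtRing A a) :
    ∃ N : ℕ, ∃ b ∈ A, ∃ c ∈ A, ∀ e, f e * a e.1.1 ^ N = b e.1.1 + c e.1.1 * e.1.2 := by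
  induction hf using Algebra.adjoin_induction with
  | mem f hf =>
    rcases hf with ⟨b, hb, rfl⟩ | rfl | rfl
    · exact ⟨0, b, hb, 0, A.zero_mem, fun e => by simp⟩
    · exact ⟨0, 0, A.zero_mem, 1, A.one_mem, fun e => by simp⟩
    · refine ⟨1, 0, A.zero_mem, 1, A.one_mem, fun e => ?_⟩
      rw [pow_one, ← e.2.2]
      simp [e.2.1]
  | algebraMap r => exact ⟨0, _, A.algebraMap_mem r, 0, A.zero_mem, fun e => by simp⟩
  | add f g _ _ hf hg =>
    obtain ⟨N, b, hb, c, hc, h⟩ := hf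
    obtain ⟨M, b', hb', c', hc', h'⟩ := hg
    refine ⟨N + M, b * a ^ M + b' * a ^ N, ?_, c * a ^ M + c' * a ^ N, ?_, fun e => ?_⟩
    · exact add_mem (mul_mem hb (pow_mem ha _)) (mul_mem hb' (pow_mem ha _))
    · exact add_mem (mul_mem hc (pow_mem ha _)) (mul_mem hc' (pow_mem ha _))
    · simp only [Pi.add_apply, Pi.mul_apply, Pi.pow_apply, pow_add]
      linear_combination a e.1.1 ^ M * h e + a e.1.1 ^ N * h' e
  | mul f g _ _ hf hg =>
    obtain ⟨N, b, hb, c, hc, h⟩ := hf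
    obtain ⟨M, b', hb', c', hc', h'⟩ := hg
    refine ⟨N + M, b * b' + c * c' * a, ?_, b * c' + b' * c, ?_, fun e => ?_⟩
    · exact add_mem (mul_mem hb hb') (mul_mem (mul_mem hc hc') ha)
    · exact add_mem (mul_mem hb hc') (mul_mem hb' hc)
    · simp only [Pi.add_apply, Pi.mul_apply, pow_add]
      linear_combination g e * a e.1.1 ^ M * h e +
        (b e.1.1 + c e.1.1 * e.1.2) * h' e + c e.1.1 * c' e.1.1 * e.2.2

variable [IsAlgClosed k]

/-- Regular functions descend along the double cover by an invertible square root. -/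
theorem descends_sqrt (h2 : (2 : k) ≠ 0) {X : Type u} {A : Subalgebra k (X → k)} {a : X → k}
    (ha : a ∈ A) (e₀ : SqrtPoints a) :
    Descends A (sqrtRing A a) (fun e => e.1.1) e₀ := by
  intro P hP Q hQ hQ0
  obtain ⟨M, b', hb', c', hc', h'⟩ := sqrtRing_normal_form ha hP
  obtain ⟨N, b, hb, c, hc, h⟩ := sqrtRing_normal_form ha hQ
  have ha0 : a e₀.1.1 ≠ 0 := by
    rw [← e₀.2.2]
    exact mul_ne_zero e₀.2.1 e₀.2.1
  -- The fibre over `x` contains both `t` and `-t`. The sum and the difference of the two equations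
  -- separate the parts even and odd in `t`, as `2` and `t` are invertible.
  have key : ∀ x z, (∀ e : SqrtPoints a, e.1.1 = x → z * Q e = P e) → a x ≠ 0 →
      z * (b x * a x ^ M) = b' x * a x ^ N ∧ z * (c x * a x ^ M) = c' x * a x ^ N := by
    intro x z hz hx
    obtain ⟨t, ht⟩ := IsAlgClosed.exists_pow_nat_eq (a x) (n := 2) (by norm_num)
    rw [pow_two] at ht
    have ht0 : t ≠ 0 := by
      rintro rfl
      exact hx (by simpa using ht.symm)
    have e1 := hz ⟨(x, t), ht0, ht⟩ rfl
    have e2 := hz ⟨(x, -t), neg_ne_zero.2 ht0, by simpa using ht⟩ rfl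
    have h1 := h ⟨(x, t), ht0, ht⟩
    have h1' := h' ⟨(x, t), ht0, ht⟩
    have h3 := h ⟨(x, -t), neg_ne_zero.2 ht0, by simpa using ht⟩
    have h3' := h' ⟨(x, -t), neg_ne_zero.2 ht0, by simpa using ht⟩
    simp only at h1 h1' h3 h3'
    have s1 : z * (b x + c x * t) * a x ^ M = (b' x + c' x * t) * a x ^ N := by
      rw [← h1, ← h1', ← e1]
      ring
    have s2 : z * (b x + c x * -t) * a x ^ M = (b' x + c' x * -t) * a x ^ N := by
      rw [← h3, ← h3', ← e2]
      ring
    constructor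
    · apply mul_left_cancel₀ h2
      linear_combination s1 + s2
    · apply mul_left_cancel₀ (mul_ne_zero h2 ht0)
      linear_combination s1 - s2
  -- One of the two parts of `Q` is nonzero at the base point and can serve as denominator.
  have hne : b e₀.1.1 ≠ 0 ∨ c e₀.1.1 ≠ 0 := by
    by_contra! hc
    have := h e₀
    rw [hc.1, hc.2, zero_mul, add_zero] at this
    exact mul_ne_zero hQ0 (pow_ne_zero _ ha0) this
  -- The last factor `a` makes both sides vanish where `a x = 0`: there the fibre is empty and `z`
  -- is arbitrary.
  have hmem : ∀ f ∈ A, ∀ n, f * a ^ n * a ∈ A := fun f hf n => mul_mem (mul_mem hf (pow_mem ha n)) ha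
  rcases hne with h0 | h0
  · refine ⟨_, hmem b' hb' N, _, hmem b hb M, mul_ne_zero (mul_ne_zero h0 (pow_ne_zero _ ha0)) ha0,
      fun x z hz => ?_⟩
    by_cases hx : a x = 0
    · simp [hx]
    · simp only [Pi.mul_apply, Pi.pow_apply]
      rw [← mul_assoc, (key x z hz hx).1]
  · refine ⟨_, hmem c' hc' N, _, hmem c hc M, mul_ne_zero (mul_ne_zero h0 (pow_ne_zero _ ha0)) ha0,
      fun x z hz => ?_⟩
    by_cases hx : a x = 0
    · simp [hx]
    · simp only [Pi.mul_apply, Pi.pow_apply]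
      rw [← mul_assoc, (key x z hz hx).2]

/-- A regular function that does not vanish at the base point has an invertible regular square root
on a cover. -/
theorem exists_cover_sqrt (h2 : (2 : k) ≠ 0) {X : Type u} {A : Subalgebra k (X → k)} {x₀ : X}
    {a : X → k} (ha : a ∈ A) (h0 : a x₀ ≠ 0) :
    ∃ (c : Cover A x₀), ∃ t ∈ c.B, (fun e => (t e)⁻¹) ∈ c.B ∧ ∀ e, t e ≠ 0 ∧ t e * t e = a (c.p e) := by
  obtain ⟨s, hs⟩ := IsAlgClosed.exists_pow_nat_eq (a x₀) (n := 2) (by norm_num)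
  rw [pow_two] at hs
  have hs0 : s ≠ 0 := by
    rintro rfl
    exact h0 (by simpa using hs.symm)
  exact ⟨⟨SqrtPoints a, sqrtRing A a, fun e => e.1.1, ⟨(x₀, s), hs0, hs⟩, rfl,
    fun b hb => Algebra.subset_adjoin (Or.inl ⟨b, hb, rfl⟩), descends_sqrt h2 ha _⟩,
    fun e => e.1.2, Algebra.subset_adjoin (Or.inr (Or.inl rfl)),
    Algebra.subset_adjoin (Or.inr (Or.inr rfl)), fun e => e.2⟩

/-- Finitely many regular functions that do not vanish at the base point become invertible on a
cover. -/
theorem exists_cover_inv (h2 : (2 : k) ≠ 0) {X : Type u} {A : Subalgebra k (X → k)} {x₀ : X}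
    {l : Type*} (s : Finset l) {a : l → X → k} (ha : ∀ i ∈ s, a i ∈ A) (h0 : ∀ i ∈ s, a i x₀ ≠ 0) :
    ∃ c : Cover A x₀, ∀ i ∈ s, (∀ e, a i (c.p e) ≠ 0) ∧ (fun e => (a i (c.p e))⁻¹) ∈ c.B := by
  classical
  -- The square-root cover doubles as a localization: with `t² = ∏ a j`, the inverse of `a i` is the
  -- product of the other factors times `t⁻²`.
  obtain ⟨c, t, ht, ht', h⟩ := exists_cover_sqrt h2 (prod_fun_mem ha)
    (x₀ := x₀) (Finset.prod_ne_zero_iff.2 h0)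
  refine ⟨c, fun i hi => ?_⟩
  have hne : ∀ e, ∏ j ∈ s, a j (c.p e) ≠ 0 := fun e => by
    rw [← (h e).2]
    exact mul_ne_zero (h e).1 (h e).1
  refine ⟨fun e => Finset.prod_ne_zero_iff.1 (hne e) i hi, ?_⟩
  have hr : (fun e => ∏ j ∈ s.erase i, a j (c.p e)) ∈ c.B :=
    prod_fun_mem fun j hj => c.comap_mem _ (ha j (Finset.mem_of_mem_erase hj))
  convert mul_mem hr (mul_mem ht' ht') using 1
  funext e
  have h1 := (h e).2
  rw [← Finset.mul_prod_erase s _ hi] at h1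
  have h3 := Finset.prod_ne_zero_iff.1 (hne e) i hi
  have h4 := (h e).1
  simp only [Pi.mul_apply]
  field_simp
  rw [← h1]
  ring

end Cover

/-! ## Normal forms of symmetric and skew-symmetric matrices on covers -/

section Congruence

universe u

open Matrix

/-- `S` becomes congruent to the constant matrix `J` on a cover. -/
def LocallyCongruent {k : Type u} [Field k] {X : Type u} (A : Subalgebra k (X → k)) (x₀ : X)
    {ι μ : Type} [Fintype ι] [DecidableEq ι] [Fintype μ] [DecidableEq μ] (S : X → Matrix ι ι k)
    (J : Matrix μ μ k) : Prop :=
  ∃ (c : Cover A x₀) (γ : c.E → Matrix ι μ k) (γ' : c.E → Matrix μ ι k),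
    RegMatrix c.B γ ∧ RegMatrix c.B γ' ∧
      ∀ e, γ e * γ' e = 1 ∧ γ' e * γ e = 1 ∧ S (c.p e) = γ e * J * (γ e)ᵀ

/-- Every family of `ε`-symmetric matrices of size `n` which is nondegenerate at the base point is
locally congruent to `J`. -/
def IsNormalForm {k : Type u} [Field k] (ε : k) (n : ℕ) {μ : Type} [Fintype μ] [DecidableEq μ]
    (J : Matrix μ μ k) : Prop :=
  ∀ (ι : Type) [Fintype ι] [DecidableEq ι], Fintype.card ι = n →
    ∀ (X : Type u) (A : Subalgebra k (X → k)) (x₀ : X) (S : X → Matrix ι ι k), RegMatrix A S →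
      (∀ x, (S x)ᵀ = ε • S x) → (S x₀).det ≠ 0 → LocallyCongruent A x₀ S J

variable {k : Type u} [Field k]

/-- Block Gauss elimination with `(a J)⁻¹ = a⁻¹ Jᵀ`. The signs cancel because `ε Jᵀ = J`, so the
elimination matrix is `a⁻¹ Bᵀ J`. -/
theorem fromBlocks_eq_schur {κ ι : Type} [Fintype κ] [DecidableEq κ] [Fintype ι] [DecidableEq ι]
    {ε a : k} (hε : ε * ε = 1) (ha : a ≠ 0) {J : Matrix κ κ k} (hJ : J * Jᵀ = 1) (hJε : Jᵀ = ε • J)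
    (B : Matrix κ ι k) (D : Matrix ι ι k) :
    fromBlocks (a • J) B (ε • Bᵀ) D =
      fromBlocks 1 0 (a⁻¹ • (Bᵀ * J)) 1 * fromBlocks (a • J) 0 0 (D - a⁻¹ • (Bᵀ * J * B)) *
        (fromBlocks 1 0 (a⁻¹ • (Bᵀ * J)) 1)ᵀ := by
  have hJJ : J * J = ε • (1 : Matrix κ κ k) := by
    rw [← hJ, hJε, mul_smul_comm, smul_smul, hε, one_smul]
  simp only [fromBlocks_transpose, fromBlocks_multiply, transpose_smul, transpose_mul,
    transpose_transpose, transpose_one, transpose_zero, Matrix.mul_one,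
    Matrix.mul_zero, Matrix.zero_mul, add_zero, zero_add, Matrix.smul_mul, Matrix.mul_smul,
    smul_smul, mul_inv_cancel₀ ha, inv_mul_cancel₀ ha, one_smul, one_mul]
  congr 1
  · rw [← Matrix.mul_assoc, hJ, Matrix.one_mul]
  · rw [Matrix.mul_assoc, hJJ, Matrix.mul_smul, Matrix.mul_one]
  · have : Bᵀ * J * J * (Jᵀ * B) = Bᵀ * J * B := by
      rw [Matrix.mul_assoc _ J, ← Matrix.mul_assoc J, hJ, Matrix.one_mul]
    rw [this]
    simp

theorem isNormalForm_zero (ε : k) : IsNormalForm ε 0 (0 : Matrix Empty Empty k) := by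
  intro ι _ _ hι X A x₀ S _ _ _
  have : IsEmpty ι := Fintype.card_eq_zero_iff.1 hι
  exact ⟨Cover.refl A x₀, fun _ => 0, fun _ => 0, RegMatrix.const _, RegMatrix.const _,
    fun e => ⟨Subsingleton.elim _ _, Subsingleton.elim _ _, Subsingleton.elim _ _⟩⟩

theorem exists_apply_ne_zero {ι : Type} [Fintype ι] [DecidableEq ι] [Nonempty ι]
    {S : Matrix ι ι k} (h : S.det ≠ 0) : ∃ i j, S i j ≠ 0 := by
  by_contra! hc
  apply h
  have : S = 0 := by
    ext i j
    exact hc i j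
  rw [this, det_zero]

variable [IsAlgClosed k]

/-- Splitting off a block `a • Jκ` from a family of `ε`-symmetric matrices. -/
theorem IsNormalForm.fromBlocks (h2 : (2 : k) ≠ 0) {ε : k} (hε : ε * ε = 1) {n : ℕ} {μ : Type}
    [Fintype μ] [DecidableEq μ] {J : Matrix μ μ k} (hJ : IsNormalForm ε n J)
    {κ : Type} [Fintype κ] [DecidableEq κ] {Jκ : Matrix κ κ k} (h1 : Jκ * Jκᵀ = 1)
    (hκ : Jκᵀ = ε • Jκ) {ι : Type} [Fintype ι] [DecidableEq ι]
    (hι : Fintype.card ι = n + Fintype.card κ)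
    {X : Type u} {A : Subalgebra k (X → k)} {x₀ : X} {S : X → Matrix ι ι k} (hS : RegMatrix A S)
    (hSε : ∀ x, (S x)ᵀ = ε • S x) (hdet : (S x₀).det ≠ 0) {C C' : Matrix ι ι k} (hC : C' * C = 1)
    {f : κ → ι} (hf : Function.Injective f) {a : X → k} (ha : a ∈ A) (ha0 : a x₀ ≠ 0)
    (hblock : ∀ x, (C * S x * Cᵀ).submatrix f f = a x • Jκ) :
    LocallyCongruent A x₀ S (Matrix.fromBlocks Jκ 0 0 J) := by
  classical
  have hC' : C * C' = 1 := mul_eq_one_comm.1 hC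
  -- Reorders the indices so that those in the range of `f` form the first block.
  let e : κ ⊕ ↥((Set.range f)ᶜ) ≃ ι :=
    ((Equiv.ofInjective f hf).sumCongr (Equiv.refl _)).trans (Equiv.Set.sumCompl (Set.range f))
  let M : X → Matrix (κ ⊕ ↥((Set.range f)ᶜ)) (κ ⊕ ↥((Set.range f)ᶜ)) k := fun x => (C * S x * Cᵀ).submatrix e e
  have hM : RegMatrix A M := (((RegMatrix.const C).mul hS).mul (RegMatrix.const Cᵀ)).submatrix e e
  have hMε : ∀ x, (M x)ᵀ = ε • M x := by
    intro x
    simp only [M, transpose_submatrix, transpose_mul, transpose_transpose, hSε]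
    rw [Matrix.smul_mul, Matrix.mul_smul, Matrix.mul_assoc]
    rfl
  let B : X → Matrix κ ↥((Set.range f)ᶜ) k := fun x => (M x).toBlocks₁₂
  let D : X → Matrix ↥((Set.range f)ᶜ) ↥((Set.range f)ᶜ) k := fun x => (M x).toBlocks₂₂
  have hB : RegMatrix A B := fun i j => hM (Sum.inl i) (Sum.inr j)
  have hD : RegMatrix A D := fun i j => hM (Sum.inr i) (Sum.inr j)
  have hDε : ∀ x, (D x)ᵀ = ε • D x := fun x => by
    ext i j
    exact congrFun (congrFun (hMε x) (Sum.inr i)) (Sum.inr j)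
  have hMblocks : ∀ x, M x = Matrix.fromBlocks (a x • Jκ) (B x) (ε • (B x)ᵀ) (D x) := by
    intro x
    rw [← fromBlocks_toBlocks (M x)]
    congr 1
    · rw [← hblock]
      rfl
    · ext i j
      have := congrFun (congrFun (hMε x) (Sum.inl j)) (Sum.inr i)
      exact this
  -- The root `t` has two uses: it inverts `a` for the Schur complement, and it gives `a • Jκ = (t •
  -- 1) * Jκ * (t • 1)ᵀ`.
  obtain ⟨c, t, ht, ht', htt⟩ := exists_cover_sqrt h2 ha ha0
  have hainv : ∀ e, (a (c.p e))⁻¹ = (t e)⁻¹ * (t e)⁻¹ := fun e => by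
    rw [← (htt e).2, mul_inv]
  have hane : ∀ e, a (c.p e) ≠ 0 := fun e => by
    rw [← (htt e).2]
    exact mul_ne_zero (htt e).1 (htt e).1
  have hai : (fun e => (a (c.p e))⁻¹) ∈ c.B := by
    simp only [hainv]
    exact mul_mem ht' ht'
  let Z : c.E → Matrix ↥((Set.range f)ᶜ) κ k := fun e => (a (c.p e))⁻¹ • ((B (c.p e))ᵀ * Jκ)
  have hZ : RegMatrix c.B Z :=
    RegMatrix.smul hai ((hB.comp c.comap_mem).transpose.mul (RegMatrix.const _))
  let T : c.E → Matrix ↥((Set.range f)ᶜ) ↥((Set.range f)ᶜ) k := fun e =>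
    D (c.p e) - (a (c.p e))⁻¹ • ((B (c.p e))ᵀ * Jκ * B (c.p e))
  have hT : RegMatrix c.B T :=
    (hD.comp c.comap_mem).sub (RegMatrix.smul hai
      (((hB.comp c.comap_mem).transpose.mul (RegMatrix.const _)).mul (hB.comp c.comap_mem)))
  have hschur : ∀ e, M (c.p e) = Matrix.fromBlocks 1 0 (Z e) 1 *
      Matrix.fromBlocks (a (c.p e) • Jκ) 0 0 (T e) * (Matrix.fromBlocks 1 0 (Z e) 1)ᵀ := fun e => by
    rw [hMblocks]
    exact fromBlocks_eq_schur hε (hane e) h1 hκ _ _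
  have hTε : ∀ e, (T e)ᵀ = ε • T e := by
    intro e
    simp only [T, transpose_sub, transpose_smul, transpose_mul, transpose_transpose, hDε, hκ,
      smul_sub, Matrix.mul_smul, Matrix.smul_mul, Matrix.mul_assoc]
    rw [smul_comm]
  have hTdet : (T c.e₀).det ≠ 0 := by
    intro h0
    have h3 := congrArg Matrix.det (hschur c.e₀)
    rw [det_mul, det_mul, det_fromBlocks_zero₁₂ (a (c.p c.e₀) • Jκ), h0, mul_zero, mul_zero,
      zero_mul, c.map_base, det_submatrix_equiv_self, det_mul, det_mul, det_transpose] at h3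
    have h4 : C.det ≠ 0 := by
      intro h5
      have := congrArg Matrix.det hC
      rw [det_mul, h5, mul_zero, det_one] at this
      exact zero_ne_one this
    exact mul_ne_zero (mul_ne_zero h4 hdet) h4 h3
  have hcard : Fintype.card ↥((Set.range f)ᶜ) = n := by
    have := Fintype.card_congr e
    rw [Fintype.card_sum] at this
    omega
  -- The Schur complement is again `ε`-symmetric and nondegenerate at the base point, of size `n`.
  -- The congruence sought is `L * R`, with `L` the elimination matrix and `R` the diagonal blocks
  -- `t` and `γ`, up to reordering and `C'`.
  obtain ⟨c', γ, γ', hγ, hγ', hγγ⟩ := hJ _ hcard c.E c.B c.e₀ T hT hTε hTdet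
  have hZ' := hZ.comp c'.comap_mem
  let L : c'.E → Matrix (κ ⊕ ↥((Set.range f)ᶜ)) (κ ⊕ ↥((Set.range f)ᶜ)) k := fun e =>
    Matrix.fromBlocks 1 0 (Z (c'.p e)) 1
  let L' : c'.E → Matrix (κ ⊕ ↥((Set.range f)ᶜ)) (κ ⊕ ↥((Set.range f)ᶜ)) k := fun e =>
    Matrix.fromBlocks 1 0 (-Z (c'.p e)) 1
  have hLL : ∀ e, L e * L' e = 1 := fun e => by
    simp [L, L', fromBlocks_multiply]
  have hLL' : ∀ e, L' e * L e = 1 := fun e => by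
    simp [L, L', fromBlocks_multiply]
  let R : c'.E → Matrix (κ ⊕ ↥((Set.range f)ᶜ)) (κ ⊕ μ) k := fun e =>
    Matrix.fromBlocks (t (c'.p e) • 1) 0 0 (γ e)
  let R' : c'.E → Matrix (κ ⊕ μ) (κ ⊕ ↥((Set.range f)ᶜ)) k := fun e =>
    Matrix.fromBlocks ((t (c'.p e))⁻¹ • 1) 0 0 (γ' e)
  have hRR : ∀ e, R e * R' e = 1 := fun e => by
    have := (htt (c'.p e)).1
    simp [R, R', fromBlocks_multiply, (hγγ e).1, smul_smul, this]
  have hRR' : ∀ e, R' e * R e = 1 := fun e => by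
    have := (htt (c'.p e)).1
    simp [R, R', fromBlocks_multiply, (hγγ e).2.1, smul_smul, this]
  have hRJ : ∀ e, R e * Matrix.fromBlocks Jκ 0 0 J * (R e)ᵀ =
      Matrix.fromBlocks (a (c.p (c'.p e)) • Jκ) 0 0 (T (c'.p e)) := fun e => by
    simp [R, fromBlocks_multiply, fromBlocks_transpose, (hγγ e).2.2, smul_smul, (htt (c'.p e)).2]
  have hLreg : RegMatrix c'.B L :=
    (RegMatrix.const 1).fromBlocks (RegMatrix.const 0) hZ' (RegMatrix.const 1)
  have hLreg' : RegMatrix c'.B L' :=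
    (RegMatrix.const 1).fromBlocks (RegMatrix.const 0) hZ'.neg (RegMatrix.const 1)
  have hRreg : RegMatrix c'.B R :=
    (RegMatrix.smul (c'.comap_mem _ ht) (RegMatrix.const 1)).fromBlocks (RegMatrix.const 0)
      (RegMatrix.const 0) hγ
  have hRreg' : RegMatrix c'.B R' :=
    (RegMatrix.smul (c'.comap_mem _ ht') (RegMatrix.const 1)).fromBlocks (RegMatrix.const 0)
      (RegMatrix.const 0) hγ'
  refine ⟨c.comp c', fun x => C' * (L x * R x).submatrix e.symm id,
    fun x => (R' x * L' x).submatrix id e.symm * C,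
    (RegMatrix.const _).mul ((hLreg.mul hRreg).submatrix _ _),
    ((hRreg'.mul hLreg').submatrix _ _).mul (RegMatrix.const _), fun (x : c'.E) => ⟨?_, ?_, ?_⟩⟩
  · have h3 : L x * R x * (R' x * L' x) = 1 := by
      rw [Matrix.mul_assoc, ← Matrix.mul_assoc (R x), hRR, Matrix.one_mul, hLL]
    have h4 : (L x * R x).submatrix e.symm id * (R' x * L' x).submatrix id e.symm = 1 := by
      rw [← submatrix_mul _ _ _ _ _ Function.bijective_id, h3, submatrix_one_equiv]
    rw [Matrix.mul_assoc, ← Matrix.mul_assoc (submatrix _ _ _), h4, Matrix.one_mul, hC]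
  · have h3 : R' x * L' x * (L x * R x) = 1 := by
      rw [Matrix.mul_assoc, ← Matrix.mul_assoc (L' x), hLL', Matrix.one_mul, hRR']
    rw [Matrix.mul_assoc, ← Matrix.mul_assoc C, hC', Matrix.one_mul,
      ← submatrix_mul _ _ _ _ _ e.symm.bijective, h3, submatrix_id_id]
  · have h3 : (L x * R x) * Matrix.fromBlocks Jκ 0 0 J * (L x * R x)ᵀ = M (c.p (c'.p x)) := by
      rw [hschur, ← hRJ]
      simp only [transpose_mul, Matrix.mul_assoc, L]
    have h4 : C * S (c.p (c'.p x)) * Cᵀ = (M (c.p (c'.p x))).submatrix e.symm e.symm := by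
      simp [M]
    have h5 : S (c.p (c'.p x)) = C' * (C * S (c.p (c'.p x)) * Cᵀ) * C'ᵀ := by
      simp only [Matrix.mul_assoc]
      rw [← transpose_mul, hC, ← Matrix.mul_assoc C', hC]
      simp
    change S (c.p (c'.p x)) = _
    rw [h5, h4, ← h3, submatrix_mul _ _ _ id _ Function.bijective_id,
      submatrix_mul _ _ _ id _ Function.bijective_id, submatrix_id_id, ← transpose_submatrix]
    simp only [transpose_mul, Matrix.mul_assoc]

/-- A constant change of basis makes some diagonal entry nonzero at the base point, and that entry
is split off. -/
theorem isNormalForm_symm_succ (h2 : (2 : k) ≠ 0) {n : ℕ} {μ : Type} [Fintype μ] [DecidableEq μ]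
    {J : Matrix μ μ k} (hJ : IsNormalForm 1 n J) :
    IsNormalForm 1 (n + 1) (Matrix.fromBlocks (1 : Matrix Unit Unit k) 0 0 J) := by
  intro ι _ _ hι X A x₀ S hS hSε hdet
  have : Nonempty ι := Fintype.card_pos_iff.1 (by omega)
  suffices ∃ (C C' : Matrix ι ι k) (i : ι), C' * C = 1 ∧ (C * S x₀ * Cᵀ) i i ≠ 0 by
    obtain ⟨C, C', i, hC, h0⟩ := this
    refine hJ.fromBlocks h2 (one_mul 1) (by simp) (by simp) hι hS hSε hdet hC
      (f := fun _ => i) (fun _ _ _ => rfl)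
      ((((RegMatrix.const C).mul hS).mul (RegMatrix.const Cᵀ)) i i) h0 fun x => ?_
    ext
    simp
  by_cases hd : ∃ i, S x₀ i i ≠ 0
  · obtain ⟨i, hi⟩ := hd
    exact ⟨1, 1, i, by simp, by simpa using hi⟩
  · push Not at hd
    obtain ⟨i, j, hij⟩ := exists_apply_ne_zero hdet
    have hne : i ≠ j := by
      rintro rfl
      exact hij (hd i)
    have hs : S x₀ j i = S x₀ i j := by
      have := congrFun (congrFun (hSε x₀) i) j
      simpa using this
    -- Replacing `e_i` by `e_i + e_j` turns the zero diagonal entry into `2 S_ij`.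
    refine ⟨transvection i j 1, transvection i j (-1), i, ?_, ?_⟩
    · rw [transvection_mul_transvection_same _ _ hne]
      simp
    · have ht : (transvection i j (1 : k))ᵀ = transvection j i 1 := by
        simp [transvection, transpose_single]
      rw [ht, mul_transvection_apply_same, transvection_mul_apply_same,
        transvection_mul_apply_same, hd, hd, hs]
      intro h
      apply mul_ne_zero h2 hij
      linear_combination h

/-- The diagonal vanishes identically, so the rows and columns `i`, `j` of an entry nonzero at the
base point form `S_ij` times the standard `2 × 2` block, with no change of basis. -/
theorem isNormalForm_skew_add_two (h2 : (2 : k) ≠ 0) {n : ℕ} {μ : Type} [Fintype μ]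
    [DecidableEq μ] {J : Matrix μ μ k} (hJ : IsNormalForm (-1) n J) :
    IsNormalForm (-1) (n + 2) (Matrix.fromBlocks (!![0, 1; -1, 0] : Matrix (Fin 2) (Fin 2) k) 0 0 J) := by
  intro ι _ _ hι X A x₀ S hS hSε hdet
  have : Nonempty ι := Fintype.card_pos_iff.1 (by omega)
  have hs : ∀ x i j, S x j i = - S x i j := fun x i j => by
    have := congrFun (congrFun (hSε x) i) j
    simpa using this
  have hd : ∀ x i, S x i i = 0 := fun x i => by
    have := hs x i i
    apply mul_left_cancel₀ h2
    linear_combination this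
  obtain ⟨i, j, hij⟩ := exists_apply_ne_zero hdet
  have hne : i ≠ j := by
    rintro rfl
    exact hij (hd _ i)
  refine hJ.fromBlocks h2 (by ring) (κ := Fin 2) ?_ ?_ (by simpa using hι) hS hSε hdet
    (one_mul 1) (f := ![i, j]) ?_ (hS i j) hij fun x => ?_
  · ext p q
    fin_cases p <;> fin_cases q <;> simp [Matrix.mul_apply]
  · ext p q
    fin_cases p <;> fin_cases q <;> simp
  · intro p q h
    fin_cases p <;> fin_cases q <;> first | rfl | exact absurd h hne | exact absurd h.symm hne
  · have h3 := hs x i j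
    ext p q
    fin_cases p <;> fin_cases q <;> simp [hd, h3]

theorem exists_isNormalForm (h2 : (2 : k) ≠ 0) {ε : k} (hε : ε = 1 ∨ ε = -1) (n : ℕ) :
    ∃ (μ : Type) (_ : Fintype μ) (_ : DecidableEq μ) (J : Matrix μ μ k), IsNormalForm ε n J := by
  rcases hε with rfl | rfl
  · induction n with
    | zero => exact ⟨_, _, _, _, isNormalForm_zero 1⟩
    | succ n ih =>
      obtain ⟨μ, _, _, J, hJ⟩ := ih
      exact ⟨_, _, _, _, isNormalForm_symm_succ h2 hJ⟩
  · induction n using Nat.twoStepInduction with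
    | zero => exact ⟨_, _, _, _, isNormalForm_zero (-1)⟩
    | one =>
      refine ⟨Empty, inferInstance, inferInstance, 0, fun ι _ _ hι X A x₀ S _ hSε hdet => ?_⟩
      obtain ⟨i, hi⟩ := Fintype.card_eq_one_iff.1 hι
      have : Nonempty ι := ⟨i⟩
      obtain ⟨p, q, h⟩ := exists_apply_ne_zero hdet
      rw [hi p, hi q] at h
      have := congrFun (congrFun (hSε x₀) i) i
      simp only [transpose_apply, Matrix.smul_apply, smul_eq_mul] at this
      exact absurd (mul_left_cancel₀ h2 (by linear_combination this)) h
    | more n ih _ =>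
      obtain ⟨μ, _, _, J, hJ⟩ := ih
      exact ⟨_, _, _, _, isNormalForm_skew_add_two h2 hJ⟩

/-- Families of `ε`-symmetric matrices that are nondegenerate at the base point are, on a cover,
congruent to any given nondegenerate `ε`-symmetric matrix. -/
theorem exists_cover_congruent (h2 : (2 : k) ≠ 0) {ε : k} (hε : ε = 1 ∨ ε = -1) {n : ℕ}
    {X : Type u} {A : Subalgebra k (X → k)} {x₀ : X} {S : X → Matrix (Fin n) (Fin n) k}
    (hS : RegMatrix A S) (hSε : ∀ x, (S x)ᵀ = ε • S x) (hdet : (S x₀).det ≠ 0)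
    {Ω : Matrix (Fin n) (Fin n) k} (hΩε : Ωᵀ = ε • Ω) (hΩ : Ω.det ≠ 0) :
    ∃ (c : Cover A x₀) (γ : c.E → GL (Fin n) k), RegGL c.B γ ∧
      ∀ e, S (c.p e) = (γ e).val * Ω * (γ e).valᵀ := by
  obtain ⟨μ, _, _, J, hJ⟩ := exists_isNormalForm h2 hε n
  obtain ⟨c, γ, γ', hγ, hγ', h⟩ := hJ (Fin n) (Fintype.card_fin n) X A x₀ S hS hSε hdet
  -- The constant family `Ω` over a point shows that `J` is congruent to `Ω` itself by a constant
  -- matrix.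
  obtain ⟨c₀, γ₀, γ₀', -, -, h₀⟩ := hJ (Fin n) (Fintype.card_fin n) PUnit ⊤ PUnit.unit
    (fun _ => Ω) (fun _ _ => Algebra.mem_top) (fun _ => hΩε) hΩ
  obtain ⟨h3, h4, h5⟩ := h₀ c₀.e₀
  have h6 : J = γ₀' c₀.e₀ * Ω * (γ₀' c₀.e₀)ᵀ := by
    change Ω = _ at h5
    rw [h5]
    simp only [Matrix.mul_assoc]
    rw [← transpose_mul, h4, ← Matrix.mul_assoc (γ₀' _), h4]
    simp
  refine ⟨c, fun e => ⟨γ e * γ₀' c₀.e₀, γ₀ c₀.e₀ * γ' e, ?_, ?_⟩,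
    ⟨hγ.mul (RegMatrix.const _), (RegMatrix.const _).mul hγ'⟩, fun e => ?_⟩
  · rw [Matrix.mul_assoc, ← Matrix.mul_assoc (γ₀' _), h4, Matrix.one_mul, (h e).1]
  · rw [Matrix.mul_assoc, ← Matrix.mul_assoc (γ' e), (h e).2.1, Matrix.one_mul, h3]
  · rw [(h e).2.2, congrArg (γ e * ·) h6]
    simp only [transpose_mul, Matrix.mul_assoc]

end Congruence

/-! ## The bipartite blow-up of a symmetric quiver -/

namespace SymQuiver

variable (Q : SymQuiver)

/-- The direction of the `i`-th arrow. -/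
def dir (i : ℕ) : Bool := if h : i < Q.m then Q.right ⟨i, h⟩ else false

/-- The direction of the even arrows of the blow-up. -/
def evenDir : Bool := if Q.m % 2 = 1 then !Q.dir (Q.m / 2) else false

/-- The contraction on the left half of the blow-up: the arrow `i` of `Q` is replaced by the two
arrows `2 i` and `2 i + 1`, and the one which has the wrong direction is contracted. -/
def foldNat (j : ℕ) : ℕ := if j % 2 = 1 ∧ Q.dir (j / 2) = Q.evenDir then j / 2 + 1 else j / 2

/-- A bipartite symmetric quiver with an even number of vertices which contracts to `Q`. -/
def blowup : SymQuiver where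
  m := 2 * Q.m + 1
  right b := if b.val % 2 = 0 then Q.evenDir else !Q.evenDir
  right_rev b := by
    have : b.rev.val % 2 = b.val % 2 := by
      rw [Fin.val_rev]
      omega
    simp only [this]
  sign := Q.sign

/-- For even `Q.m` the middle arrow is contracted and its direction is a free choice; this one puts
its head at the vertex `Q.m`, which is even and in the left half. -/
theorem evenDir_of_even (h : Q.m % 2 = 0) : Q.evenDir = false := by
  simp [evenDir, h]

/-- For odd `Q.m` the middle arrow of the blow-up has odd index and must carry the fixed arrow of
`Q`, so the odd arrows take the direction of that arrow. -/
theorem dir_middle_ne (h : Q.m % 2 = 1) : Q.dir (Q.m / 2) ≠ Q.evenDir := by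
  simp [evenDir, h]

theorem foldNat_le {j : ℕ} (hj : j ≤ Q.m) : 2 * Q.foldNat j ≤ Q.m := by
  unfold foldNat
  split_ifs with h
  -- Only `j = Q.m` odd could leave the left half, and the choice of `evenDir` excludes it.
  · by_contra hc
    have h1 : j = Q.m := by omega
    subst h1
    exact Q.dir_middle_ne h.1 h.2
  · omega

/-- The contraction of the blow-up to `Q`, on vertices. -/
def fold (z : Q.blowup.V) : Q.V :=
  if h : z.val ≤ Q.m then ⟨Q.foldNat z.val, by have := Q.foldNat_le h; omega⟩
  else ⟨Q.m - Q.foldNat (2 * Q.m + 1 - z.val), by omega⟩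

theorem blowup_lt (z : Q.blowup.V) : z.val < 2 * Q.m + 2 := z.2

theorem blowup_arrow_lt (b : Fin Q.blowup.m) : b.val < 2 * Q.m + 1 := b.2

theorem val_rev_blowup (z : Q.blowup.V) : z.rev.val = 2 * Q.m + 1 - z.val := by
  rw [Fin.val_rev]
  change 2 * Q.m + 1 + 1 - (z.val + 1) = _
  omega

theorem val_rev_blowup_arrow (b : Fin Q.blowup.m) : b.rev.val = 2 * Q.m - b.val := by
  rw [Fin.val_rev]
  change 2 * Q.m + 1 - (b.val + 1) = _
  omega

theorem blowup_rev_ne (z : Q.blowup.V) : z.rev ≠ z := by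
  intro h
  have h1 := congrArg Fin.val h
  rw [val_rev_blowup] at h1
  omega

theorem blowup_left_iff (z : Q.blowup.V) : z ≤ z.rev ↔ z.val ≤ Q.m := by
  rw [Fin.le_def, val_rev_blowup]
  omega

theorem val_rev (w : Q.V) : w.rev.val = Q.m - w.val := by
  rw [Fin.val_rev]
  omega

theorem fold_of_left {z : Q.blowup.V} (h : z.val ≤ Q.m) : (Q.fold z).val = Q.foldNat z.val := by
  rw [fold, dif_pos h]

theorem fold_of_right {z : Q.blowup.V} (h : ¬ z.val ≤ Q.m) :
    (Q.fold z).val = Q.m - Q.foldNat (2 * Q.m + 1 - z.val) := by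
  rw [fold, dif_neg h]

theorem fold_rev (z : Q.blowup.V) : Q.fold z.rev = (Q.fold z).rev := by
  have hz := Q.blowup_lt z
  have h1 := Q.val_rev_blowup z
  apply Fin.ext
  rw [val_rev]
  by_cases h : z.val ≤ Q.m
  · rw [Q.fold_of_left h, Q.fold_of_right (by omega), h1]
    congr 2
    omega
  · have h2 := Q.foldNat_le (j := 2 * Q.m + 1 - z.val) (by omega)
    rw [Q.fold_of_right h, Q.fold_of_left (by omega), h1]
    omega

theorem fold_left {z : Q.blowup.V} (h : z ≤ z.rev) : Q.fold z ≤ (Q.fold z).rev := by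
  rw [blowup_left_iff] at h
  rw [Fin.le_def, val_rev, Q.fold_of_left h]
  have := Q.foldNat_le h
  omega

theorem foldNat_even {j : ℕ} (h : j % 2 = 0) : Q.foldNat j = j / 2 := by
  simp [foldNat, h]

theorem foldNat_odd_pos {j : ℕ} (h : j % 2 = 1) (h' : Q.dir (j / 2) = Q.evenDir) :
    Q.foldNat j = j / 2 + 1 := by
  simp [foldNat, h, h']

theorem foldNat_odd_neg {j : ℕ} (h' : Q.dir (j / 2) ≠ Q.evenDir) :
    Q.foldNat j = j / 2 := by
  simp [foldNat, h']

/-- The vertex of the blow-up over a vertex in the left half. -/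
def anchor (w : Q.V) : Q.blowup.V :=
  ⟨2 * w.val, by
    change _ < 2 * Q.m + 2
    omega⟩

theorem anchor_left (w : Q.V) (h : w ≤ w.rev) : Q.anchor w ≤ (Q.anchor w).rev := by
  rw [blowup_left_iff]
  rw [Fin.le_def, val_rev] at h
  change 2 * w.val ≤ _
  omega

theorem fold_anchor (w : Q.V) (h : w ≤ w.rev) : Q.fold (Q.anchor w) = w := by
  apply Fin.ext
  rw [Q.fold_of_left ((Q.blowup_left_iff _).1 (Q.anchor_left w h)), foldNat_even]
  · change 2 * w.val / 2 = _
    omega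
  · change 2 * w.val % 2 = _
    omega

theorem val_tail (b : Fin Q.m) : (Q.tail b).val = if Q.right b then b.val else b.val + 1 := by
  unfold tail
  split <;> simp

theorem val_head (b : Fin Q.m) : (Q.head b).val = if Q.right b then b.val + 1 else b.val := by
  unfold head
  split <;> simp

theorem tail_ne_head (a : Fin Q.m) : Q.tail a ≠ Q.head a := by
  intro h
  have := congrArg Fin.val h
  rw [val_tail, val_head] at this
  split at this <;> omega

theorem tail_rev (a : Fin Q.m) : Q.tail a.rev = (Q.head a).rev := by
  rw [← Fin.rev_rev (Q.tail a.rev), ← Q.head_rev, Fin.rev_rev]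

theorem dir_val (a : Fin Q.m) : Q.dir a.val = Q.right a := by
  simp [dir]

theorem blowup_right (b : Fin Q.blowup.m) :
    Q.blowup.right b = if b.val % 2 = 0 then Q.evenDir else !Q.evenDir := rfl

/-- Directions alternate along the path, so all heads have one parity and all tails the other; this
is what makes the blow-up bipartite. -/
theorem head_blowup_mod (b : Fin Q.blowup.m) :
    (Q.blowup.head b).val % 2 = if Q.evenDir then 1 else 0 := by
  rw [val_head, blowup_right]
  cases Q.evenDir <;> by_cases h : b.val % 2 = 0 <;> simp [h] <;> omega

theorem tail_blowup_mod (b : Fin Q.blowup.m) :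
    (Q.blowup.tail b).val % 2 = if Q.evenDir then 0 else 1 := by
  rw [val_tail, blowup_right]
  cases Q.evenDir <;> by_cases h : b.val % 2 = 0 <;> simp [h] <;> omega

theorem blowup_isBipartite : Q.blowup.IsBipartite := by
  intro z
  by_cases h : z.val % 2 = if Q.evenDir then 1 else 0
  · left
    rintro a rfl
    rw [tail_blowup_mod] at h
    split at h <;> omega
  · right
    rintro a rfl
    exact h (Q.head_blowup_mod a)

/-! ### Lifted and contracted arrows of the blow-up -/

theorem blowup_arrow_le (b : Q.blowup.Arrow) : b.1.val ≤ Q.m := by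
  have := b.2
  rw [Fin.le_def, val_rev_blowup_arrow] at this
  omega

theorem blowup_fixed_iff (b : Fin Q.blowup.m) : b.rev = b ↔ b.val = Q.m := by
  rw [Fin.ext_iff, val_rev_blowup_arrow]
  have := Q.blowup_arrow_lt b
  omega

theorem fixed_iff (a : Fin Q.m) : a.rev = a ↔ 2 * a.val + 1 = Q.m := by
  rw [Fin.ext_iff, Fin.val_rev]
  have := a.2
  omega

theorem arrow_iff (a : Fin Q.m) : a ≤ a.rev ↔ 2 * a.val + 1 ≤ Q.m := by
  rw [Fin.le_def, Fin.val_rev]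
  have := a.2
  omega

/-- The arrow of the blow-up which carries an arrow in the left half. -/
def lift (a : Q.Arrow) : Q.blowup.Arrow :=
  ⟨⟨if Q.right a.1 = Q.evenDir then 2 * a.1.val else 2 * a.1.val + 1, by
      have := a.1.2
      change _ < 2 * Q.m + 1
      split <;> omega⟩, by
    have := (Q.arrow_iff a.1).1 a.2
    rw [Fin.le_def, val_rev_blowup_arrow]
    simp only
    split <;> omega⟩

theorem lift_val (a : Q.Arrow) : (Q.lift a).1.val =
    if Q.right a.1 = Q.evenDir then 2 * a.1.val else 2 * a.1.val + 1 := rfl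

theorem fold_end_of_middle {z : Q.blowup.V} (h : z.val = Q.m + 1) :
    (Q.fold z).val = Q.m - Q.foldNat Q.m := by
  rw [Q.fold_of_right (by omega)]
  congr 2
  omega

theorem fold_ends_lift (a : Q.Arrow) :
    Q.fold (Q.blowup.tail (Q.lift a).1) = Q.tail a.1 ∧
      Q.fold (Q.blowup.head (Q.lift a).1) = Q.head a.1 := by
  have ha := (Q.arrow_iff a.1).1 a.2
  have hv := Q.lift_val a
  have hd := Q.dir_val a.1
  by_cases hr : Q.right a.1 = Q.evenDir
  · rw [if_pos hr] at hv
    have hR : Q.blowup.right (Q.lift a).1 = Q.right a.1 := by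
      rw [blowup_right, if_pos (by omega), hr]
    have hm : (Q.lift a).1.val + 1 ≤ Q.m := by omega
    have h1 : Q.foldNat (2 * a.1.val) = a.1.val := by
      rw [Q.foldNat_even (by omega)]
      omega
    have h2 : Q.foldNat (2 * a.1.val + 1) = a.1.val + 1 := by
      have h3 : (2 * a.1.val + 1) / 2 = a.1.val := by omega
      rw [Q.foldNat_odd_pos (by omega) (by rw [h3, hd, hr]), h3]
    have ht := Q.blowup.val_tail (Q.lift a).1
    have hh := Q.blowup.val_head (Q.lift a).1
    have ht' := Q.val_tail a.1
    have hh' := Q.val_head a.1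
    rw [hR, hv] at ht hh
    constructor
    · apply Fin.ext
      rw [Q.fold_of_left (by rw [ht]; split <;> omega), ht, ht']
      split <;> assumption
    · apply Fin.ext
      rw [Q.fold_of_left (by rw [hh]; split <;> omega), hh, hh']
      split <;> assumption
  · rw [if_neg hr] at hv
    have hR : Q.blowup.right (Q.lift a).1 = Q.right a.1 := by
      rw [blowup_right, if_neg (by omega)]
      revert hr
      cases Q.right a.1 <;> cases Q.evenDir <;> simp
    have h3 : (2 * a.1.val + 1) / 2 = a.1.val := by omega
    have h1 : Q.foldNat (2 * a.1.val + 1) = a.1.val := by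
      rw [Q.foldNat_odd_neg (by rw [h3, hd]; exact hr), h3]
    have ht := Q.blowup.val_tail (Q.lift a).1
    have hh := Q.blowup.val_head (Q.lift a).1
    have ht' := Q.val_tail a.1
    have hh' := Q.val_head a.1
    rw [hR, hv] at ht hh
    have key : ∀ z : Q.blowup.V, z.val = 2 * a.1.val + 1 + 1 → (Q.fold z).val = a.1.val + 1 := by
      intro z hz
      by_cases hm : 2 * a.1.val + 1 + 1 ≤ Q.m
      · rw [Q.fold_of_left (by omega), hz, Q.foldNat_even (by omega)]
        omega
      -- Here the lift is the middle arrow; its right end lies in the right half, where `fold` is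
      -- defined by reflection.
      · have h4 : Q.m = 2 * a.1.val + 1 := by omega
        have h5 : Q.foldNat Q.m = a.1.val := (congrArg Q.foldNat h4).trans h1
        rw [Q.fold_end_of_middle (by omega), h5]
        omega
    have key' : ∀ z : Q.blowup.V, z.val = 2 * a.1.val + 1 → (Q.fold z).val = a.1.val := by
      intro z hz
      rw [Q.fold_of_left (by omega), hz, h1]
    constructor
    · apply Fin.ext
      rw [ht']
      split at ht <;> rename_i h6
      · rw [if_pos h6]
        exact key' _ ht
      · rw [if_neg h6]
        exact key _ ht
    · apply Fin.ext
      rw [hh']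
      split at hh <;> rename_i h6
      · rw [if_pos h6]
        exact key _ hh
      · rw [if_neg h6]
        exact key' _ hh

/-- An arrow of the blow-up is contracted. -/
def Contracted (b : Fin Q.blowup.m) : Prop :=
  Q.fold (Q.blowup.head b) = Q.fold (Q.blowup.tail b)

instance : DecidablePred Q.Contracted := fun _ => inferInstanceAs (Decidable (_ = _))

theorem not_contracted_lift (a : Q.Arrow) : ¬ Q.Contracted (Q.lift a).1 := by
  intro h
  unfold Contracted at h
  rw [(Q.fold_ends_lift a).1, (Q.fold_ends_lift a).2] at h
  exact Q.tail_ne_head a.1 h.symm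

theorem lift_fixed_iff (a : Q.Arrow) : (Q.lift a).1.rev = (Q.lift a).1 ↔ a.1.rev = a.1 := by
  rw [blowup_fixed_iff, fixed_iff, lift_val]
  have ha := (Q.arrow_iff a.1).1 a.2
  have hm := Q.dir_middle_ne
  constructor
  · split <;> intro h <;> omega
  · intro h
    have h3 : Q.m / 2 = a.1.val := by omega
    rw [h3, dir_val] at hm
    rw [if_neg (hm (by omega))]
    exact h

/-- In the left half the arrows pair up as `2 i`, `2 i + 1`, one of each pair being a lift. For even
`Q.m` the middle arrow is left over, and both its ends go to the fixed vertex. -/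
theorem exists_lift_or_contracted (b : Q.blowup.Arrow) :
    Q.Contracted b.1 ∨ ∃ a, Q.lift a = b := by
  have hb := Q.blowup_arrow_le b
  by_cases h : ∃ a, Q.lift a = b
  · exact Or.inr h
  left
  push Not at h
  have hne : ∀ (a : Fin Q.m), 2 * a.val + 1 ≤ Q.m →
      (if Q.dir a.val = Q.evenDir then 2 * a.val else 2 * a.val + 1) ≠ b.1.val := by
    intro a ha h1
    apply h ⟨a, (Q.arrow_iff a).2 ha⟩
    apply Subtype.ext
    apply Fin.ext
    rw [lift_val, ← h1, dir_val]
  have key : Q.fold b.1.castSucc = Q.fold b.1.succ := by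
    apply Fin.ext
    have h1 : (Fin.castSucc b.1).val = b.1.val := rfl
    have h2 : b.1.succ.val = b.1.val + 1 := Fin.val_succ b.1
    rw [Q.fold_of_left (z := Fin.castSucc b.1) (by omega), h1]
    by_cases hm : b.1.val = Q.m
    · rw [Q.fold_end_of_middle (by omega), hm]
      rcases Nat.mod_two_eq_zero_or_one Q.m with h0 | h0
      · rw [Q.foldNat_even h0]
        omega
      · exfalso
        have h3 : Q.m / 2 < Q.m := by omega
        apply hne ⟨Q.m / 2, h3⟩ (by simp only; omega)
        rw [if_neg (Q.dir_middle_ne h0)]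
        simp only
        omega
    · rw [Q.fold_of_left (by omega), h2]
      rcases Nat.mod_two_eq_zero_or_one b.1.val with h0 | h0
      · rw [Q.foldNat_even h0]
        have h3 : (b.1.val + 1) / 2 = b.1.val / 2 := by omega
        have h4 : b.1.val / 2 < Q.m := by omega
        have h5 := hne ⟨b.1.val / 2, h4⟩ (by simp only; omega)
        simp only at h5
        rw [Q.foldNat_odd_neg, h3]
        intro h6
        rw [h3] at h6
        rw [if_pos h6] at h5
        omega
      · have h4 : b.1.val / 2 < Q.m := by omega
        have h5 := hne ⟨b.1.val / 2, h4⟩ (by simp only; omega)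
        simp only at h5
        rw [Q.foldNat_even (by omega : (b.1.val + 1) % 2 = 0), Q.foldNat_odd_pos h0]
        · omega
        · by_contra h6
          rw [if_neg h6] at h5
          omega
  unfold Contracted head tail
  split
  · exact key.symm
  · exact key

theorem lift_injective : Function.Injective Q.lift := by
  intro a a' h
  have h1 : (Q.lift a).1.val = (Q.lift a').1.val := by rw [h]
  rw [lift_val, lift_val] at h1
  apply Subtype.ext
  apply Fin.ext
  split at h1 <;> split at h1 <;> omega

/-- The arrow carried by an arrow of the blow-up that is not contracted. -/
def unlift (b : Q.blowup.Arrow) (h : ¬ Q.Contracted b.1) : Q.Arrow :=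
  ((Q.exists_lift_or_contracted b).resolve_left h).choose

theorem lift_unlift (b : Q.blowup.Arrow) (h : ¬ Q.Contracted b.1) : Q.lift (Q.unlift b h) = b :=
  ((Q.exists_lift_or_contracted b).resolve_left h).choose_spec

theorem unlift_lift (a : Q.Arrow) (h : ¬ Q.Contracted (Q.lift a).1) : Q.unlift (Q.lift a) h = a :=
  Q.lift_injective (Q.lift_unlift _ h)

theorem fold_ends_of_not_contracted (b : Fin Q.blowup.m) (h : ¬ Q.Contracted b) :
    ∃ a, Q.tail a = Q.fold (Q.blowup.tail b) ∧ Q.head a = Q.fold (Q.blowup.head b) := by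
  rcases le_total b b.rev with hb | hb
  · have h1 := Q.fold_ends_lift (Q.unlift ⟨b, hb⟩ h)
    rw [Q.lift_unlift] at h1
    exact ⟨_, h1.1.symm, h1.2.symm⟩
  · have h' : ¬ Q.Contracted b.rev := by
      intro h1
      unfold Contracted at h1
      rw [Q.blowup.head_rev, Q.blowup.tail_rev, fold_rev, fold_rev] at h1
      exact h (Fin.rev_injective h1).symm
    have h1 := Q.fold_ends_lift (Q.unlift ⟨b.rev, by rwa [Fin.rev_rev]⟩ h')
    rw [Q.lift_unlift] at h1
    simp only [Q.blowup.head_rev, Q.blowup.tail_rev, fold_rev] at h1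
    refine ⟨(Q.unlift ⟨b.rev, by rwa [Fin.rev_rev]⟩ h').1.rev, ?_, ?_⟩
    · rw [Q.tail_rev, ← h1.2, Fin.rev_rev]
    · rw [Q.head_rev, ← h1.1, Fin.rev_rev]

theorem foldNat_le_succ (j : ℕ) : Q.foldNat j ≤ Q.foldNat (j + 1) := by
  unfold foldNat
  split_ifs <;> omega

theorem fold_monotone : Monotone Q.fold := by
  refine Fin.monotone_iff_le_succ.2 fun b => ?_
  have hb := Q.blowup_arrow_lt b
  have h1 : (Fin.castSucc b).val = b.val := rfl
  have h2 : b.succ.val = b.val + 1 := Fin.val_succ b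
  rw [Fin.le_def]
  rcases lt_trichotomy b.val Q.m with h | h | h
  · rw [Q.fold_of_left (z := b.castSucc) (by omega), Q.fold_of_left (by omega), h1, h2]
    exact Q.foldNat_le_succ _
  · rw [Q.fold_of_left (z := b.castSucc) (by omega), Q.fold_end_of_middle (by omega), h1, h]
    have := Q.foldNat_le (le_refl Q.m)
    omega
  · rw [Q.fold_of_right (z := b.castSucc) (by omega), Q.fold_of_right (by omega), h1, h2]
    have := Q.foldNat_le_succ (2 * Q.m + 1 - (b.val + 1))
    rw [show 2 * Q.m + 1 - (b.val + 1) + 1 = 2 * Q.m + 1 - b.val by omega] at this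
    omega

theorem fold_surjective : Function.Surjective Q.fold := by
  intro w
  rcases le_total w w.rev with h | h
  · exact ⟨_, Q.fold_anchor w h⟩
  · refine ⟨(Q.anchor w.rev).rev, ?_⟩
    rw [fold_rev, Q.fold_anchor _ (by rwa [Fin.rev_rev]), Fin.rev_rev]

/-- The contraction of the blow-up to `Q`. -/
def contraction : Contraction Q.blowup Q where
  ν := Q.fold
  monotone := Q.fold_monotone
  surjective := Q.fold_surjective
  map_rev := Q.fold_rev
  map_arrow b := by
    by_cases h : Q.Contracted b
    · exact Or.inl h.symm
    · exact Or.inr (Q.fold_ends_of_not_contracted b h)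
  sign_eq := rfl

/-! ### Contracted arrows -/

theorem ends_left (b : Q.blowup.Arrow) (h : b.1.rev ≠ b.1) :
    Q.blowup.tail b.1 ≤ (Q.blowup.tail b.1).rev ∧ Q.blowup.head b.1 ≤ (Q.blowup.head b.1).rev := by
  have hb := Q.blowup_arrow_le b
  rw [Ne, blowup_fixed_iff] at h
  rw [blowup_left_iff, blowup_left_iff, val_tail, val_head]
  constructor <;> split <;> omega

theorem fold_fixed_of_contracted {b : Fin Q.blowup.m} (hb : b.rev = b) (h : Q.Contracted b) :
    (Q.fold (Q.blowup.head b)).rev = Q.fold (Q.blowup.head b) := by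
  rw [← fold_rev, Q.blowup.head_eq_of_fixed hb, Fin.rev_rev, ← h, Q.blowup.head_eq_of_fixed hb]

theorem m_even_of_fixed {w : Q.V} (h : w.rev = w) : 2 * w.val = Q.m := by
  have h1 := congrArg Fin.val h
  rw [val_rev] at h1
  omega

theorem head_even_of_contracted {b : Fin Q.blowup.m} (hb : b.rev = b) (h : Q.Contracted b) :
    (Q.blowup.head b).val = Q.m ∧ Q.m % 2 = 0 := by
  have h1 := Q.m_even_of_fixed (Q.fold_fixed_of_contracted hb h)
  have h2 : Q.m % 2 = 0 := by omega
  rw [blowup_fixed_iff] at hb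
  rw [val_head, blowup_right, hb, if_pos h2, Q.evenDir_of_even h2]
  simp [h2]

theorem head_left_of_contracted {b : Fin Q.blowup.m} (hb : b.rev = b) (h : Q.Contracted b) :
    Q.blowup.head b ≤ (Q.blowup.head b).rev := by
  rw [blowup_left_iff, (Q.head_even_of_contracted hb h).1]

theorem exists_middle {w : Q.V} (hw : w.rev = w) :
    ∃ b : Q.blowup.Arrow, b.1.rev = b.1 ∧ Q.Contracted b.1 ∧
      Q.blowup.head b.1 = Q.anchor w := by
  have hw' := Q.m_even_of_fixed hw
  have hlt : Q.m < 2 * Q.m + 1 := by omega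
  let b : Fin Q.blowup.m := ⟨Q.m, hlt⟩
  have hb : b.rev = b := (Q.blowup_fixed_iff b).2 rfl
  have hc : Q.Contracted b := by
    rcases Q.exists_lift_or_contracted ⟨b, hb.ge⟩ with h | ⟨a, ha⟩
    · exact h
    · exfalso
      have h1 : (Q.lift a).1.rev = (Q.lift a).1 := by rw [ha]; exact hb
      rw [lift_fixed_iff, fixed_iff] at h1
      omega
  refine ⟨⟨b, hb.ge⟩, hb, hc, Fin.ext ?_⟩
  rw [(Q.head_even_of_contracted hb hc).1]
  exact hw'.symm

/-- Each odd vertex in the left half is an end of exactly one arrow that is contracted. -/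
theorem exists_contracted_of_odd {z : Q.blowup.V} (hz : z ≤ z.rev) (hodd : z.val % 2 = 1) :
    ∃ b : Q.blowup.Arrow, b.1.rev ≠ b.1 ∧ Q.Contracted b.1 ∧
      (if Q.evenDir then Q.blowup.head b.1 else Q.blowup.tail b.1) = z := by
  rw [blowup_left_iff] at hz
  have hnl : ∀ c : Q.blowup.Arrow, ¬ Q.Contracted c.1 →
      c.1.val = if Q.dir (c.1.val / 2) = Q.evenDir then 2 * (c.1.val / 2) else 2 * (c.1.val / 2) + 1 := by
    intro c hc
    have h1 := congrArg (fun c : Q.blowup.Arrow => c.1.val) (Q.lift_unlift c hc)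
    simp only [lift_val] at h1
    rw [← dir_val] at h1
    have h2 : c.1.val / 2 = (Q.unlift c hc).1.val := by
      split at h1 <;> omega
    rw [h2]
    exact h1.symm
  -- By the parity of heads and tails, an odd vertex is the head of both adjacent arrows or the tail
  -- of both, according to `evenDir`.
  have hval : ∀ c : Fin Q.blowup.m, (c.val + 1 = z.val ∨ c.val = z.val) →
      (if Q.evenDir then Q.blowup.head c else Q.blowup.tail c) = z := by
    intro c hc
    have h1 := Q.head_blowup_mod c
    have h2 := Q.tail_blowup_mod c
    have h3 := Q.blowup.val_head c
    have h4 := Q.blowup.val_tail c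
    apply Fin.ext
    cases hE : Q.evenDir <;> rw [hE] at h1 h2 <;> simp only [Bool.false_eq_true, if_true, if_false] at h1 h2 ⊢
    · split at h4 <;> omega
    · split at h3 <;> omega
  -- For `z = 2 i + 1` the candidates are the arrows `2 i` and `2 i + 1`; the one not carrying the
  -- arrow `i` is contracted.
  by_cases hd : Q.dir (z.val / 2) = Q.evenDir
  · have hne : z.val ≠ Q.m := by
      intro h
      rw [h] at hd hodd
      exact Q.dir_middle_ne hodd hd
    have hlt : z.val < 2 * Q.m + 1 := by omega
    let b : Fin Q.blowup.m := ⟨z.val, hlt⟩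
    have hb : b ≤ b.rev := by
      rw [Fin.le_def, val_rev_blowup_arrow]
      change z.val ≤ 2 * Q.m - z.val
      omega
    refine ⟨⟨b, hb⟩, fun h => hne ((Q.blowup_fixed_iff b).1 h), ?_, hval b (Or.inr rfl)⟩
    by_contra hc
    have := hnl ⟨b, hb⟩ hc
    change z.val = if Q.dir (z.val / 2) = _ then _ else _ at this
    rw [if_pos hd] at this
    change _ = 2 * (z.val / 2) at this
    omega
  · have hlt : z.val - 1 < 2 * Q.m + 1 := by omega
    let b : Fin Q.blowup.m := ⟨z.val - 1, hlt⟩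
    have hbv : b.val = z.val - 1 := rfl
    have hb : b ≤ b.rev := by
      rw [Fin.le_def, val_rev_blowup_arrow]
      omega
    refine ⟨⟨b, hb⟩, fun h => ?_, ?_, hval b (Or.inl (by omega))⟩
    · have := (Q.blowup_fixed_iff b).1 h
      omega
    · by_contra hc
      have h1 := hnl ⟨b, hb⟩ hc
      have h2 : (z.val - 1) / 2 = z.val / 2 := by omega
      simp only [hbv, h2] at h1
      rw [if_neg hd] at h1
      omega

/-- Two different arrows with the same odd end form a pair `2 i`, `2 i + 1`, and one of them is a
lift. -/
theorem contracted_unique {b b' : Q.blowup.Arrow} (hb : Q.Contracted b.1) (hb' : Q.Contracted b'.1)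
    (h : (if Q.evenDir then Q.blowup.head b.1 else Q.blowup.tail b.1) =
      if Q.evenDir then Q.blowup.head b'.1 else Q.blowup.tail b'.1) : b = b' := by
  have hbl := Q.blowup_arrow_le b
  have hbl' := Q.blowup_arrow_le b'
  have key : ∀ c : Q.blowup.Arrow, ((if Q.evenDir then Q.blowup.head c.1 else
      Q.blowup.tail c.1 : Q.blowup.V).val + 1) / 2 = c.1.val / 2 + 1 := by
    intro c
    have h1 := Q.head_blowup_mod c.1
    have h2 := Q.tail_blowup_mod c.1
    have h3 := Q.blowup.val_head c.1
    have h4 := Q.blowup.val_tail c.1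
    cases hE : Q.evenDir <;> rw [hE] at h1 h2 <;>
      simp only [Bool.false_eq_true, if_true, if_false] at h1 h2 ⊢
    · split at h4 <;> omega
    · split at h3 <;> omega
  have h1 : b.1.val / 2 = b'.1.val / 2 := by
    have := key b
    rw [h, key b'] at this
    omega
  by_contra hne
  have h2 : b.1.val ≠ b'.1.val := fun h3 => hne (Subtype.ext (Fin.ext h3))
  have h4 : b.1.val / 2 < Q.m := by omega
  let a : Q.Arrow := ⟨⟨b.1.val / 2, h4⟩, (Q.arrow_iff _).2 (by simp only; omega)⟩
  have h5 := Q.lift_val a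
  have h6 : a.1.val = b.1.val / 2 := rfl
  have h7 : (Q.lift a).1.val = b.1.val ∨ (Q.lift a).1.val = b'.1.val := by
    split at h5 <;> omega
  rcases h7 with h7 | h7
  · exact Q.not_contracted_lift a (by rwa [show (Q.lift a).1 = b.1 from Fin.ext h7])
  · exact Q.not_contracted_lift a (by rwa [show (Q.lift a).1 = b'.1 from Fin.ext h7])

end SymQuiver

/-! ## Matrices along equalities of sizes -/

section Recast

variable {k : Type*} {a b c d : ℕ}

/-- Transport of a matrix along equalities of sizes. -/
def recast (h : a = b) (h' : c = d) (M : Matrix (Fin a) (Fin c) k) : Matrix (Fin b) (Fin d) k :=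
  M.submatrix (Fin.cast h.symm) (Fin.cast h'.symm)

@[simp]
theorem recast_rfl (M : Matrix (Fin a) (Fin c) k) : recast rfl rfl M = M := rfl

theorem recast_injective (h : a = b) (h' : c = d) :
    Function.Injective (recast h h' : Matrix (Fin a) (Fin c) k → Matrix (Fin b) (Fin d) k) := by
  subst h h'
  exact fun _ _ h => h

variable [Field k]

/-- Transport of an invertible matrix along an equality of sizes. -/
def castGL (h : a = b) (g : GL (Fin a) k) : GL (Fin b) k := h ▸ g

@[simp]
theorem castGL_rfl (g : GL (Fin a) k) : castGL rfl g = g := rfl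

theorem castGL_apply_of_eq {α : Type*} {r : α → ℕ} (f : ∀ x, GL (Fin (r x)) k)
    {x y : α} (h : x = y) (hr : r x = r y) : castGL hr (f x) = f y := by
  subst h
  rfl

theorem contra_contra (h : b = a) (h' : c = b) (g : GL (Fin a) k) :
    contra h' (contra h g) = castGL (h'.trans h).symm g := by
  subst h h'
  apply Units.ext
  ext i j
  rfl

theorem contra_inv_val (h : b = a) (g : GL (Fin a) k) :
    ((contra h g)⁻¹).val = recast h.symm h.symm g.val.transpose := rfl

theorem eq_castGL_of_mul (h : a = b) {x : GL (Fin a) k} {y : GL (Fin b) k}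
    (H : x.val * recast rfl h (1 : Matrix (Fin a) (Fin a) k) * (y⁻¹).val = recast rfl h 1) : y = castGL h x := by
  subst h
  have h1 : x * y⁻¹ = 1 := Units.ext (by simpa using H)
  exact (mul_inv_eq_one.1 h1).symm

theorem RegGL.contra {X : Type*} {A : Subalgebra k (X → k)} {g : X → GL (Fin a) k}
    (hg : RegGL A g) (h : b = a) : RegGL A (fun x => contra h (g x)) :=
  ⟨fun _ _ => hg.2 _ _, fun _ _ => hg.1 _ _⟩

theorem RegMatrix.recast {X : Type*} {A : Subalgebra k (X → k)} {M : X → Matrix (Fin a) (Fin c) k}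
    (hM : RegMatrix A M) (h : a = b) (h' : c = d) : RegMatrix A (fun x => recast h h' (M x)) :=
  fun _ _ => hM _ _

end Recast

/-! ## Elements of `G(d)` -/

namespace SymDim

variable {k : Type*} [Field k] {Q : SymQuiver}

theorem G_apply_eq_contra {d : SymDim k Q} (g : d.G) {w z : Q.V} (h : w = z.rev) (hz : z.rev ≠ z)
    (e : d.dim w = d.dim z) : g.1 w = contra e (g.1 z) := by
  subst h
  exact g.2.1 z hz

theorem G_ext {d : SymDim k Q} {g g' : d.G} (h : ∀ z, z ≤ z.rev → g.1 z = g'.1 z) : g = g' := by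
  apply Subtype.ext
  funext z
  by_cases hz : z ≤ z.rev
  · exact h z hz
  · have hr : z = z.rev.rev := (Fin.rev_rev z).symm
    have hne : z.rev.rev ≠ z.rev := by
      rw [Fin.rev_rev]
      exact fun h => hz h.le
    rw [G_apply_eq_contra g hr hne (d.dim_rev z).symm,
      G_apply_eq_contra g' hr hne (d.dim_rev z).symm, h z.rev (by
        rw [Fin.rev_rev]
        exact (not_le.1 hz).le)]

variable (d : SymDim k Q)

/-- The element of `G(d)` with given components in the left half. -/
def mkG (f : ∀ z, GL (Fin (d.dim z)) k)
    (hf : ∀ z hz, (f z).val.transpose * d.Ω z hz * (f z).val = d.Ω z hz) : d.G :=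
  ⟨fun z => if z ≤ z.rev then f z else contra (d.dim_rev z).symm (f z.rev), by
    constructor
    · intro z hz
      beta_reduce
      by_cases h : z ≤ z.rev
      · have h' : ¬ z.rev ≤ z.rev.rev := by
          rw [Fin.rev_rev]
          exact fun h' => hz (le_antisymm h' h)
        rw [if_pos h, if_neg h']
        have : ∀ w (hw : w = z) (e : d.dim z.rev = d.dim w), contra e (f w) =
            contra (d.dim_rev z) (f z) := by
          rintro w rfl e
          rfl
        exact this _ (Fin.rev_rev z) _
      · have h' : z.rev ≤ z.rev.rev := by
          rw [Fin.rev_rev]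
          exact (not_le.1 h).le
        rw [if_pos h', if_neg h, contra_contra]
        rfl
    · intro z hz
      beta_reduce
      rw [if_pos hz.ge]
      exact hf z hz⟩

variable {d}

theorem mkG_of_left {f : ∀ z, GL (Fin (d.dim z)) k} {hf} {z : Q.V} (h : z ≤ z.rev) :
    (d.mkG f hf).1 z = f z := if_pos h

theorem smul_apply (g : d.G) (W : d.srep) (a : Q.Arrow) :
    (g • W).1 a = (g.1 (Q.head a.1)).val * W.1 a * ((g.1 (Q.tail a.1))⁻¹).val := rfl

/-- Thus the group acts at a fixed arrow by congruence, `M ↦ x M xᵀ` with `x` the component at the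
head. -/
theorem inv_apply_tail_of_fixed (g : d.G) {a : Fin Q.m} (ha : a.rev = a) :
    ((g.1 (Q.tail a))⁻¹).val =
      recast (d.dim_head ha) (d.dim_head ha) (g.1 (Q.head a)).val.transpose := by
  have h : Q.tail a = (Q.head a).rev := by rw [Q.head_eq_of_fixed ha, Fin.rev_rev]
  have hne : (Q.head a).rev ≠ Q.head a := by
    rw [← h]
    exact Q.tail_ne_head a
  rw [G_apply_eq_contra g h hne (d.dim_head ha).symm, contra_inv_val]

theorem head_not_fixed {a : Fin Q.m} (ha : a.rev = a) : (Q.head a).rev ≠ Q.head a := by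
  rw [Q.head_eq_of_fixed ha, Fin.rev_rev, ← Q.head_eq_of_fixed ha]
  exact Q.tail_ne_head a

/-! ### Regularity of maps into `G(d)` and out of the coordinate rings -/

section Rings

variable {E : Type*} {B : Subalgebra k (E → k)}

theorem regGL_apply (z : Q.V) : RegGL d.groupRing (fun g => g.1 z) :=
  ⟨fun i j => Algebra.subset_adjoin (Or.inl ⟨z, i, j, rfl⟩),
    fun i j => Algebra.subset_adjoin (Or.inr ⟨z, i, j, rfl⟩)⟩

theorem regMatrix_apply (a : Q.Arrow) : RegMatrix d.srepRing (fun W => W.1 a) :=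
  fun i j => Algebra.subset_adjoin ⟨a, i, j, rfl⟩

theorem regGL_of_left {F : E → d.G} (h : ∀ z, z ≤ z.rev → RegGL B (fun e => (F e).1 z)) (z : Q.V) :
    RegGL B (fun e => (F e).1 z) := by
  by_cases hz : z ≤ z.rev
  · exact h z hz
  · have hr : z = z.rev.rev := (Fin.rev_rev z).symm
    have hne : z.rev.rev ≠ z.rev := by
      rw [Fin.rev_rev]
      exact fun h => hz h.le
    have h1 := h z.rev (by
      rw [Fin.rev_rev]
      exact (not_le.1 hz).le)
    have h2 : (fun e => (F e).1 z) = fun e => contra (d.dim_rev z).symm ((F e).1 z.rev) := by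
      funext e
      exact G_apply_eq_contra (F e) hr hne _
    rw [h2]
    exact h1.contra _

/-- The pullback of a regular function on `G(d)` along a regular map is regular. -/
theorem comp_mem_of_groupRing {F : E → d.G} (h : ∀ z, RegGL B (fun e => (F e).1 z)) {f : d.G → k}
    (hf : f ∈ d.groupRing) : f ∘ F ∈ B := by
  induction hf using Algebra.adjoin_induction with
  | mem f hf =>
    rcases hf with ⟨z, i, j, rfl⟩ | ⟨z, i, j, rfl⟩
    exacts [(h z).1 i j, (h z).2 i j]
  | algebraMap r => exact B.algebraMap_mem r
  | add f g _ _ hf hg => exact add_mem hf hg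
  | mul f g _ _ hf hg => exact mul_mem hf hg

theorem comp_mem_of_srepRing {F : E → d.srep} (h : ∀ a, RegMatrix B (fun e => (F e).1 a))
    {f : d.srep → k} (hf : f ∈ d.srepRing) : f ∘ F ∈ B := by
  induction hf using Algebra.adjoin_induction with
  | mem f hf =>
    obtain ⟨a, i, j, rfl⟩ := hf
    exact h a i j
  | algebraMap r => exact B.algebraMap_mem r
  | add f g _ _ hf hg => exact add_mem hf hg
  | mul f g _ _ hf hg => exact mul_mem hf hg

end Rings

/-! ## The pullback of a dimension vector to the blow-up -/

variable (d)

/-- The pullback of a dimension vector to the blow-up. -/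
abbrev blowup : SymDim k Q.blowup where
  dim z := d.dim (Q.fold z)
  dim_rev z := by rw [Q.fold_rev, d.dim_rev]
  Ω z hz := absurd hz (Q.blowup_rev_ne z)
  isUnit_Ω z hz := absurd hz (Q.blowup_rev_ne z)
  Ω_transpose z hz := absurd hz (Q.blowup_rev_ne z)

/-- The embedding of `G(d)` in the group of the blow-up. -/
def pullback : d.G →* d.blowup.G where
  toFun h := d.blowup.mkG (fun z => h.1 (Q.fold z)) fun z hz => absurd hz (Q.blowup_rev_ne z)
  map_one' := by
    apply G_ext
    intro z hz
    rw [mkG_of_left hz]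
    rfl
  map_mul' h h' := by
    apply G_ext
    intro z hz
    change _ = (d.blowup.mkG _ _).1 z * (d.blowup.mkG _ _).1 z
    rw [mkG_of_left hz, mkG_of_left hz, mkG_of_left hz]
    rfl

variable {d}

theorem pullback_of_left (h : d.G) {z : Q.blowup.V} (hz : z ≤ z.rev) :
    (d.pullback h).1 z = h.1 (Q.fold z) :=
  mkG_of_left (d := d.blowup) (hf := fun z hz => absurd hz (Q.blowup_rev_ne z)) hz

/-- In the right half the pullback is defined by the inverse transpose. This agrees with `h` at the
folded vertex unless that vertex is fixed: an element of `K` is in general not its own inverse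
transpose. -/
theorem pullback_of_not_fixed (h : d.G) {z : Q.blowup.V} (hz : (Q.fold z).rev ≠ Q.fold z) :
    (d.pullback h).1 z = h.1 (Q.fold z) := by
  by_cases hl : z ≤ z.rev
  · exact pullback_of_left h hl
  · have hr : z = z.rev.rev := (Fin.rev_rev z).symm
    have h1 := Q.fold_rev z
    rw [G_apply_eq_contra (d.pullback h) hr (Q.blowup_rev_ne _) (d.blowup.dim_rev z).symm,
      pullback_of_left h (by
        rw [Fin.rev_rev]
        exact (not_le.1 hl).le),
      G_apply_eq_contra h (w := Q.fold z) (z := Q.fold z.rev) (by rw [h1, Fin.rev_rev])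
        (by rw [h1, Fin.rev_rev]; exact hz.symm) (d.blowup.dim_rev z).symm]

/-- The lift of a fixed arrow has an end in the right half, but its ends fold to vertices that are
not fixed. -/
theorem pullback_lift (h : d.G) (a : Q.Arrow) :
    (d.pullback h).1 (Q.blowup.head (Q.lift a).1) = h.1 (Q.fold (Q.blowup.head (Q.lift a).1)) ∧
      (d.pullback h).1 (Q.blowup.tail (Q.lift a).1) =
        h.1 (Q.fold (Q.blowup.tail (Q.lift a).1)) := by
  by_cases ha : a.1.rev = a.1
  · constructor
    · apply pullback_of_not_fixed
      rw [(Q.fold_ends_lift a).2]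
      exact head_not_fixed ha
    · apply pullback_of_not_fixed
      rw [(Q.fold_ends_lift a).1]
      exact tail_not_fixed ha
  · have h1 := Q.ends_left (Q.lift a) (fun h => ha ((Q.lift_fixed_iff a).1 h))
    exact ⟨pullback_of_left h h1.2, pullback_of_left h h1.1⟩

/-! ## The slice -/

theorem sign_cases (Q : SymQuiver) : (((Q.sign : ℤ) : k)) = 1 ∨ (((Q.sign : ℤ) : k)) = -1 := by
  rcases Int.units_eq_one_or Q.sign with h | h <;> simp [h]

/-- Makes `Ω⁻¹` an admissible value at the fixed arrow of the blow-up. -/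
theorem Ω_inv_transpose (d : SymDim k Q) (z : Q.V) (hz : z.rev = z) :
    ((d.Ω z hz)⁻¹).transpose = ((Q.sign : ℤ) : k) • (d.Ω z hz)⁻¹ := by
  have hu := (Matrix.isUnit_iff_isUnit_det _).1 (d.isUnit_Ω z hz)
  rw [Matrix.transpose_nonsing_inv, d.Ω_transpose]
  rcases sign_cases (k := k) Q with h | h
  · rw [h, one_smul, one_smul]
  · rw [h]
    apply Matrix.inv_eq_left_inv
    simp [Matrix.nonsing_inv_mul _ hu]

variable (d)

/-- The value at the contracted arrows of the representations in the slice, as a square matrix. -/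
def sliceValue (b : Q.blowup.Arrow) (hc : Q.Contracted b.1) :
    Matrix (Fin (d.dim (Q.fold (Q.blowup.head b.1)))) (Fin (d.dim (Q.fold (Q.blowup.head b.1)))) k :=
  if hb : b.1.rev = b.1 then (d.Ω _ (Q.fold_fixed_of_contracted hb hc))⁻¹ else 1

/-- Extend a representation of `Q` by the standard values at the contracted arrows. -/
def sliceFamily (V : d.Family) : d.blowup.Family := fun b =>
  if hc : Q.Contracted b.1 then recast rfl (congrArg d.dim hc) (d.sliceValue b hc)
  else recast (by rw [← (Q.fold_ends_lift _).2, Q.lift_unlift b hc])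
    (by rw [← (Q.fold_ends_lift _).1, Q.lift_unlift b hc]) (V (Q.unlift b hc))

variable {d}

theorem sliceFamily_contracted (V : d.Family) (b : Q.blowup.Arrow) (hc : Q.Contracted b.1) :
    d.sliceFamily V b = recast rfl (congrArg d.dim hc) (d.sliceValue b hc) := dif_pos hc

theorem dim_head_lift (d : SymDim k Q) (a : Q.Arrow) :
    d.dim (Q.head a.1) = d.blowup.dim (Q.blowup.head (Q.lift a).1) :=
  congrArg d.dim (Q.fold_ends_lift a).2.symm

theorem dim_tail_lift (d : SymDim k Q) (a : Q.Arrow) :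
    d.dim (Q.tail a.1) = d.blowup.dim (Q.blowup.tail (Q.lift a).1) :=
  congrArg d.dim (Q.fold_ends_lift a).1.symm

theorem sliceFamily_lift (V : d.Family) (a : Q.Arrow) :
    d.sliceFamily V (Q.lift a) = recast (d.dim_head_lift a) (d.dim_tail_lift a) (V a) := by
  have hc := Q.not_contracted_lift a
  have : ∀ a' (h : a' = a) (h1 : d.dim (Q.head a'.1) = d.blowup.dim (Q.blowup.head (Q.lift a).1))
      (h2 : d.dim (Q.tail a'.1) = d.blowup.dim (Q.blowup.tail (Q.lift a).1)),
      recast h1 h2 (V a') = recast (d.dim_head_lift a) (d.dim_tail_lift a) (V a) := by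
    rintro _ rfl _ _
    rfl
  rw [sliceFamily, dif_neg hc]
  exact this _ (Q.unlift_lift a hc) _ _

theorem sliceFamily_mem {V : d.Family} (hV : V ∈ d.srep) : d.sliceFamily V ∈ d.blowup.srep := by
  intro b hb i j
  rcases Q.exists_lift_or_contracted b with hc | ⟨a, rfl⟩
  · rw [sliceFamily_contracted V b hc]
    have h1 : d.sliceValue b hc = (d.Ω _ (Q.fold_fixed_of_contracted hb hc))⁻¹ := dif_pos hb
    rw [h1]
    have h2 := congrFun (congrFun (d.Ω_inv_transpose _ (Q.fold_fixed_of_contracted hb hc))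
      (Fin.cast (congrArg d.dim hc.symm) j)) i
    exact h2
  · rw [sliceFamily_lift]
    have ha := (Q.lift_fixed_iff a).1 hb
    exact hV a ha (Fin.cast (d.dim_head_lift a).symm i) (Fin.cast (d.dim_tail_lift a).symm j)

variable (d)

/-- The slice: extension of a representation of `Q` by the standard values. -/
def slice (V : d.srep) : d.blowup.srep := ⟨d.sliceFamily V.1, sliceFamily_mem V.2⟩

/-- Restriction of a representation of the blow-up to the arrows that are not contracted. -/
def restrict (W : d.blowup.srep) : d.srep :=
  ⟨fun a => recast (d.dim_head_lift a).symm (d.dim_tail_lift a).symm (W.1 (Q.lift a)), by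
    intro a ha i j
    exact W.2 (Q.lift a) ((Q.lift_fixed_iff a).2 ha) (Fin.cast (d.dim_head_lift a) i)
      (Fin.cast (d.dim_tail_lift a) j)⟩

variable {d}

theorem restrict_slice (V : d.srep) : d.restrict (d.slice V) = V := by
  apply Subtype.ext
  funext a
  change recast (d.dim_head_lift a).symm (d.dim_tail_lift a).symm
    (d.sliceFamily V.1 (Q.lift a)) = _
  rw [sliceFamily_lift]
  rfl

theorem slice_injective : Function.Injective d.slice :=
  Function.LeftInverse.injective restrict_slice

theorem slice_restrict {W : d.blowup.srep}
    (h : ∀ b hc, W.1 b = recast rfl (congrArg d.dim hc) (d.sliceValue b hc)) :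
    d.slice (d.restrict W) = W := by
  apply Subtype.ext
  funext b
  rcases Q.exists_lift_or_contracted b with hc | ⟨a, rfl⟩
  · exact (sliceFamily_contracted _ b hc).trans (h b hc).symm
  · exact sliceFamily_lift _ a

theorem recast_mul_inv {a b c c' : ℕ} (h : a = b) (h' : c = c') (x : GL (Fin a) k)
    (y : GL (Fin c) k) (M : Matrix (Fin a) (Fin c) k) (x' : GL (Fin b) k) (y' : GL (Fin c') k)
    (hx : x' = castGL h x) (hy : y' = castGL h' y) :
    x'.val * recast h h' M * (y'⁻¹).val = recast h h' (x.val * M * (y⁻¹).val) := by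
  subst h h' hx hy
  rfl

theorem mul_recast_transpose {a b : ℕ} (h : a = b) (x M : Matrix (Fin a) (Fin a) k)
    (y : Matrix (Fin a) (Fin a) k) :
    x * recast rfl h M * recast h h y = recast rfl h (x * M * y) := by
  subst h
  rfl

/-- The standard values are invariant: the ends of a contracted arrow off the middle get the same
component of `h`, and `x Ω⁻¹ xᵀ = Ω⁻¹` for `x` in `K`. -/
theorem slice_smul (h : d.G) (V : d.srep) : d.slice (h • V) = d.pullback h • d.slice V := by
  apply Subtype.ext
  funext b
  rw [smul_apply]
  change d.sliceFamily _ b = _ * d.sliceFamily _ b * _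
  rcases Q.exists_lift_or_contracted b with hc | ⟨a, rfl⟩
  · rw [sliceFamily_contracted _ b hc, sliceFamily_contracted _ b hc]
    by_cases hb : b.1.rev = b.1
    · rw [inv_apply_tail_of_fixed _ hb, pullback_of_left h (Q.head_left_of_contracted hb hc)]
      refine Eq.trans ?_ (mul_recast_transpose (congrArg d.dim hc) _ _ _).symm
      congr 1
      have h1 : d.sliceValue b hc = (d.Ω _ (Q.fold_fixed_of_contracted hb hc))⁻¹ := dif_pos hb
      rw [h1]
      have hu := (Matrix.isUnit_iff_isUnit_det _).1
        (d.isUnit_Ω _ (Q.fold_fixed_of_contracted hb hc))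
      have h3 := h.2.2 _ (Q.fold_fixed_of_contracted hb hc)
      generalize d.Ω _ (Q.fold_fixed_of_contracted hb hc) = Ω at *
      apply Matrix.inv_eq_left_inv
      generalize h.1 (Q.fold (Q.blowup.head b.1)) = x at *
      have h4 : x.val.transpose * Ω = Ω * (x⁻¹).val := by
        rw [← congrArg (· * (x⁻¹).val) h3]
        simp only [Matrix.mul_assoc, Units.mul_inv, Matrix.mul_one]
      rw [Matrix.mul_assoc, h4, Matrix.mul_assoc, ← Matrix.mul_assoc Ω⁻¹,
        Matrix.nonsing_inv_mul _ hu, Matrix.one_mul, Units.mul_inv]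
    · have h1 : d.sliceValue b hc = 1 := dif_neg hb
      have h2 := Q.ends_left b hb
      rw [h1, pullback_of_left h h2.1, pullback_of_left h h2.2]
      have : ∀ {v w : Q.V} (hvw : v = w) (M : Matrix (Fin (d.dim v)) (Fin (d.dim v)) k),
          M = 1 → recast rfl (congrArg d.dim hvw) M =
            (h.1 v).val * recast rfl (congrArg d.dim hvw) M * ((h.1 w)⁻¹).val := by
        rintro v _ rfl _ rfl
        simp
      exact this hc _ rfl
  · rw [sliceFamily_lift, sliceFamily_lift, (pullback_lift h a).1, (pullback_lift h a).2]
    refine (recast_mul_inv _ _ (h.1 (Q.head a.1)) (h.1 (Q.tail a.1)) _ _ _ ?_ ?_).symm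
    · exact (castGL_apply_of_eq (r := d.dim) h.1 (Q.fold_ends_lift a).2.symm _).symm
    · exact (castGL_apply_of_eq (r := d.dim) h.1 (Q.fold_ends_lift a).1.symm _).symm

end SymDim

/-! ## The stabilizer of the slice and the closed embedding -/

namespace SymQuiver

variable (Q : SymQuiver)

theorem anchor_fold_of_even {z : Q.blowup.V} (hz : z ≤ z.rev) (he : z.val % 2 = 0) :
    Q.anchor (Q.fold z) = z := by
  apply Fin.ext
  change 2 * (Q.fold z).val = z.val
  rw [Q.fold_of_left ((Q.blowup_left_iff z).1 hz), Q.foldNat_even he]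
  omega

end SymQuiver

namespace SymDim

variable {k : Type*} [Field k] {Q : SymQuiver} {d : SymDim k Q}

theorem apply_tail_of_smul_slice {g : d.blowup.G} {V V' : d.srep}
    (h : g • d.slice V = d.slice V') (b : Q.blowup.Arrow) (hb : b.1.rev ≠ b.1)
    (hc : Q.Contracted b.1) :
    g.1 (Q.blowup.tail b.1) = castGL (congrArg d.dim hc) (g.1 (Q.blowup.head b.1)) := by
  have h1 := congrArg (fun W : d.blowup.srep => W.1 b) h
  simp only [smul_apply] at h1
  change _ * d.sliceFamily _ b * _ = d.sliceFamily _ b at h1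
  rw [sliceFamily_contracted _ b hc, sliceFamily_contracted _ b hc,
    show d.sliceValue b hc = 1 from dif_neg hb] at h1
  exact eq_castGL_of_mul (congrArg d.dim hc) h1

/-- The element fixes the value `Ω⁻¹` under congruence, and inverting `x Ω⁻¹ xᵀ = Ω⁻¹` gives the
defining equation of `K`. -/
theorem preserves_of_smul_slice {g : d.blowup.G} {V V' : d.srep}
    (h : g • d.slice V = d.slice V') (b : Q.blowup.Arrow) (hb : b.1.rev = b.1)
    (hc : Q.Contracted b.1) :
    (g.1 (Q.blowup.head b.1)).val.transpose * d.Ω _ (Q.fold_fixed_of_contracted hb hc) *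
      (g.1 (Q.blowup.head b.1)).val = d.Ω _ (Q.fold_fixed_of_contracted hb hc) := by
  have h1 := congrArg (fun W : d.blowup.srep => W.1 b) h
  simp only [smul_apply] at h1
  change _ * d.sliceFamily _ b * _ = d.sliceFamily _ b at h1
  rw [sliceFamily_contracted _ b hc, sliceFamily_contracted _ b hc,
    inv_apply_tail_of_fixed _ hb] at h1
  have h2 := recast_injective _ _ ((mul_recast_transpose (congrArg d.dim hc) _ _ _).symm.trans h1)
  rw [show d.sliceValue b hc = (d.Ω _ (Q.fold_fixed_of_contracted hb hc))⁻¹ from dif_pos hb] at h2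
  have hu := (Matrix.isUnit_iff_isUnit_det _).1 (d.isUnit_Ω _ (Q.fold_fixed_of_contracted hb hc))
  generalize d.Ω _ (Q.fold_fixed_of_contracted hb hc) = Ω at *
  generalize g.1 (Q.blowup.head b.1) = x at *
  have h3 : x.val * (Ω⁻¹ * x.val.transpose * Ω) = 1 := by
    rw [← Matrix.mul_assoc, ← Matrix.mul_assoc, h2, Matrix.nonsing_inv_mul _ hu]
  have h4 := mul_eq_one_comm.1 h3
  calc x.val.transpose * Ω * x.val
      = Ω * (Ω⁻¹ * x.val.transpose * Ω * x.val) := by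
        simp only [← Matrix.mul_assoc]
        rw [Matrix.mul_nonsing_inv _ hu, Matrix.one_mul]
    _ = Ω := by rw [h4, Matrix.mul_one]

/-- An odd vertex is joined by a contracted arrow to an even one, where `g` has the same component.
Even vertices of the left half are determined by their image under `fold`, so `g` is constant on the
fibres of `fold` there. -/
theorem exists_even_vertex {g : d.blowup.G} {V V' : d.srep} (h : g • d.slice V = d.slice V')
    {z : Q.blowup.V} (hz : z ≤ z.rev) :
    ∃ (y : Q.blowup.V) (e : Q.fold y = Q.fold z), y ≤ y.rev ∧ y.val % 2 = 0 ∧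
      castGL (congrArg d.dim e) (g.1 y) = g.1 z := by
  rcases Nat.mod_two_eq_zero_or_one z.val with h0 | h0
  · exact ⟨z, rfl, hz, h0, rfl⟩
  · obtain ⟨b, hb, hc, hz'⟩ := Q.exists_contracted_of_odd hz h0
    have h1 := apply_tail_of_smul_slice h b hb hc
    have h2 := Q.ends_left b hb
    have h3 := Q.head_blowup_mod b.1
    have h4 := Q.tail_blowup_mod b.1
    split at hz'
    · rename_i hE
      subst hz'
      rw [if_pos hE] at h4
      refine ⟨_, hc.symm, h2.1, h4, ?_⟩
      rw [h1]
      have : ∀ {a b : ℕ} (e : a = b) (e' : b = a) (x : GL (Fin a) k), castGL e' (castGL e x) = x := by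
        rintro a _ rfl _ x
        rfl
      exact this _ _ _
    · rename_i hE
      subst hz'
      rw [if_neg hE] at h3
      exact ⟨_, hc, h2.2, h3, h1.symm⟩

/-- An element which moves a point of the slice to a point of the slice comes from `G(d)`. -/
theorem mem_range_of_smul_slice {g : d.blowup.G} {V V' : d.srep}
    (h : g • d.slice V = d.slice V') : g ∈ d.pullback.range := by
  -- The components are read off at the even vertices; the value `1` in the right half is never used
  -- by `mkG`.
  let f : ∀ w, GL (Fin (d.dim w)) k := fun w =>
    if hw : w ≤ w.rev then castGL (congrArg d.dim (Q.fold_anchor w hw)) (g.1 (Q.anchor w)) else 1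
  have hf : ∀ w hw, (f w).val.transpose * d.Ω w hw * (f w).val = d.Ω w hw := by
    intro w hw
    obtain ⟨b, hb, hc, hba⟩ := Q.exists_middle hw
    have h1 : f w = castGL (congrArg d.dim (Q.fold_anchor w hw.ge)) (g.1 (Q.anchor w)) :=
      dif_pos hw.ge
    have key : ∀ z, z = Q.blowup.head b.1 → ∀ v (e : Q.fold z = v) (hv : v.rev = v),
        (castGL (congrArg d.dim e) (g.1 z)).val.transpose * d.Ω v hv *
          (castGL (congrArg d.dim e) (g.1 z)).val = d.Ω v hv := by
      rintro _ rfl _ rfl hv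
      exact preserves_of_smul_slice h b hb hc
    rw [h1]
    exact key _ hba.symm _ (Q.fold_anchor w hw.ge) hw
  refine ⟨d.mkG f hf, G_ext fun z hz => ?_⟩
  have hfz := Q.fold_left hz
  rw [pullback_of_left _ hz, mkG_of_left hfz]
  have h1 : f (Q.fold z) = castGL (congrArg d.dim (Q.fold_anchor _ hfz)) (g.1 (Q.anchor _)) :=
    dif_pos hfz
  obtain ⟨y, e, hy, hy0, hgy⟩ := exists_even_vertex h hz
  have key : ∀ x (hx : x = y) (e' : Q.fold x = Q.fold z),
      castGL (congrArg d.dim e') (g.1 x) = g.1 z := by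
    rintro x rfl e'
    exact hgy
  rw [h1]
  refine key _ ?_ (Q.fold_anchor _ hfz)
  rw [← Q.anchor_fold_of_even hy hy0]
  congr 1
  exact e.symm

theorem pullback_injective : Function.Injective d.pullback := by
  intro h h' hh
  refine G_ext fun w hw => ?_
  have h1 : ∀ z, z ≤ z.rev → h.1 (Q.fold z) = h'.1 (Q.fold z) := fun z hz => by
    rw [← pullback_of_left h hz, ← pullback_of_left h' hz, hh]
  have h2 := h1 _ (Q.anchor_left w hw)
  rwa [Q.fold_anchor w hw] at h2

theorem regMatrix_sliceFamily (b : Q.blowup.Arrow) :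
    RegMatrix d.srepRing (fun V => (d.slice V).1 b) := by
  change RegMatrix d.srepRing (fun V => d.sliceFamily V.1 b)
  rcases Q.exists_lift_or_contracted b with hc | ⟨a, rfl⟩
  · simp only [sliceFamily_contracted _ b hc]
    exact RegMatrix.const _
  · simp only [sliceFamily_lift]
    exact (regMatrix_apply a).recast _ _

theorem regMatrix_smul {E : Type*} {B : Subalgebra k (E → k)} {g : E → d.G} {W : E → d.srep}
    (hg : ∀ z, RegGL B (fun e => (g e).1 z)) (hW : ∀ a, RegMatrix B (fun e => (W e).1 a))
    (a : Q.Arrow) : RegMatrix B (fun e => (g e • W e).1 a) := by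
  simp only [smul_apply]
  exact ((hg _).1.mul (hW a)).mul (hg _).2

/-- The image is the stabilizer of the single point `slice 0`, which is cut out by regular
equations. -/
theorem isClosed_range_pullback :
    IsClosed[zariski d.blowup.groupRing] (Set.range d.pullback) := by
  let _ := zariski d.blowup.groupRing
  rw [← isOpen_compl_iff]
  intro g hg
  have hne : g • d.slice 0 ≠ d.slice 0 := fun h => hg (mem_range_of_smul_slice h)
  have : ∃ b i j, (g • d.slice 0).1 b i j ≠ (d.slice 0).1 b i j := by
    by_contra! hc
    apply hne
    apply Subtype.ext
    funext b
    ext i j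
    exact hc b i j
  obtain ⟨b, i, j, hij⟩ := this
  refine ⟨fun g' => (g' • d.slice 0).1 b i j - (d.slice 0).1 b i j, ?_, sub_ne_zero.2 hij, ?_⟩
  · exact sub_mem (regMatrix_smul (g := id) regGL_apply (fun a => RegMatrix.const _) b i j)
      (const_mem _ _)
  · rintro _ hg' ⟨h, rfl⟩
    apply hg'
    have h0 : h • (0 : d.srep) = 0 := by
      apply Subtype.ext
      funext a
      rw [smul_apply]
      change _ * (0 : Matrix _ _ k) * _ = 0
      rw [Matrix.mul_zero, Matrix.zero_mul]
    change (d.pullback h • d.slice 0).1 b i j - (d.slice 0).1 b i j = 0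
    rw [← slice_smul, h0, sub_self]

theorem regGL_pullback (z : Q.blowup.V) :
    RegGL d.groupRing (fun h => (d.pullback h).1 z) := by
  refine regGL_of_left (fun z hz => ?_) z
  simp only [pullback_of_left _ hz]
  exact regGL_apply _

/-- The restrictions of the regular functions along the embedding. -/
def restrictedRing (d : SymDim k Q) : Subalgebra k (d.G → k) where
  carrier := {f | ∃ F ∈ d.blowup.groupRing, f = F ∘ d.pullback}
  mul_mem' := by
    rintro _ _ ⟨F, hF, rfl⟩ ⟨F', hF', rfl⟩
    exact ⟨F * F', mul_mem hF hF', rfl⟩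
  add_mem' := by
    rintro _ _ ⟨F, hF, rfl⟩ ⟨F', hF', rfl⟩
    exact ⟨F + F', add_mem hF hF', rfl⟩
  algebraMap_mem' r := ⟨_, Subalgebra.algebraMap_mem _ r, rfl⟩

/-- The component at a vertex `w` of the left half is that of the pullback at `anchor w`. -/
theorem regGL_restrictedRing (w : Q.V) : RegGL d.restrictedRing (fun h => h.1 w) := by
  refine regGL_of_left (F := id) (fun w hw => ?_) w
  have h1 : ∀ z, z ≤ z.rev → RegGL d.restrictedRing (fun h => h.1 (Q.fold z)) := by
    intro z hz
    simp only [← pullback_of_left _ hz]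
    exact ⟨fun i j => ⟨_, (regGL_apply z).1 i j, rfl⟩, fun i j => ⟨_, (regGL_apply z).2 i j, rfl⟩⟩
  have h2 := h1 _ (Q.anchor_left w hw)
  rwa [Q.fold_anchor w hw] at h2

theorem isClosedEmbedding_pullback :
    IsClosedEmbedding d.groupRing d.blowup.groupRing d.pullback := by
  refine ⟨pullback_injective, isClosed_range_pullback, fun f => ⟨fun hf => ?_, ?_⟩⟩
  · exact comp_mem_of_groupRing (F := id) (B := d.restrictedRing) regGL_restrictedRing hf
  · rintro ⟨F, hF, rfl⟩
    exact comp_mem_of_groupRing regGL_pullback hF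

theorem isPullback_pullback : IsPullback Q.contraction (fun _ => rfl) d.pullback := by
  intro h z hz i j
  rw [pullback_of_left h hz]
  rfl

theorem smul_slice_mem {a : d.blowup.srep → k} (ha : a ∈ d.blowup.srepRing) :
    (fun p : d.blowup.G × d.srep => a (p.1 • d.slice p.2)) ∈
      prodRing d.blowup.groupRing d.srepRing := by
  refine comp_mem_of_srepRing (fun b => regMatrix_smul (fun z => ?_) (fun b => ?_) b) ha
  · exact (regGL_apply z).comp (p := Prod.fst) fun f hf =>
      Algebra.subset_adjoin (Or.inl ⟨f, hf, rfl⟩)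
  · exact (regMatrix_sliceFamily b).comp (p := Prod.snd) fun f hf =>
      Algebra.subset_adjoin (Or.inr ⟨f, hf, rfl⟩)

end SymDim

/-! ## Descent along the action map of the slice -/

theorem RegGL.castGL {k X : Type*} [Field k] {A : Subalgebra k (X → k)} {a b : ℕ}
    {g : X → GL (Fin a) k} (hg : RegGL A g) (h : a = b) : RegGL A (fun x => castGL h (g x)) := by
  subst h
  exact hg

theorem comp_mem_of_prodRing {k E X Y : Type*} [Field k] {A : Subalgebra k (X → k)}
    {B : Subalgebra k (Y → k)} {C : Subalgebra k (E → k)} {s : E → X} {t : E → Y}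
    (hs : ∀ a ∈ A, a ∘ s ∈ C) (ht : ∀ b ∈ B, b ∘ t ∈ C) {f : X × Y → k}
    (hf : f ∈ prodRing A B) : f ∘ (fun e => (s e, t e)) ∈ C := by
  induction hf using Algebra.adjoin_induction with
  | mem f hf =>
    rcases hf with ⟨a, ha, rfl⟩ | ⟨b, hb, rfl⟩
    exacts [hs a ha, ht b hb]
  | algebraMap r => exact C.algebraMap_mem r
  | add f g _ _ hf hg => exact add_mem hf hg
  | mul f g _ _ hf hg => exact mul_mem hf hg

namespace SymDim

section

variable {k : Type*} [Field k] {Q : SymQuiver} {d : SymDim k Q}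

/-- The value of a representation at a contracted arrow, as a square matrix. -/
def square (b : Q.blowup.Arrow) (hc : Q.Contracted b.1) (W : d.blowup.srep) :
    Matrix (Fin (d.dim (Q.fold (Q.blowup.head b.1)))) (Fin (d.dim (Q.fold (Q.blowup.head b.1)))) k :=
  recast rfl (congrArg d.dim hc.symm) (W.1 b)

theorem apply_eq_recast_square (b : Q.blowup.Arrow) (hc : Q.Contracted b.1) (W : d.blowup.srep) :
    W.1 b = recast rfl (congrArg d.dim hc) (square b hc W) := rfl

theorem regMatrix_square (b : Q.blowup.Arrow) (hc : Q.Contracted b.1) :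
    RegMatrix d.blowup.srepRing (square b hc) :=
  (regMatrix_apply b).recast rfl (congrArg d.dim hc.symm)

theorem det_sliceValue_ne_zero (b : Q.blowup.Arrow) (hc : Q.Contracted b.1) :
    (d.sliceValue b hc).det ≠ 0 := by
  by_cases hb : b.1.rev = b.1
  · rw [show d.sliceValue b hc = (d.Ω _ (Q.fold_fixed_of_contracted hb hc))⁻¹ from dif_pos hb]
    have hu := (Matrix.isUnit_iff_isUnit_det _).1 (d.isUnit_Ω _ (Q.fold_fixed_of_contracted hb hc))
    exact ((Matrix.isUnit_nonsing_inv_det _ hu)).ne_zero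
  · rw [show d.sliceValue b hc = 1 from dif_neg hb, Matrix.det_one]
    exact one_ne_zero

theorem det_square_ne_zero (b : Q.blowup.Arrow) (hc : Q.Contracted b.1) (g : d.blowup.G)
    (V : d.srep) : (square b hc (g • d.slice V)).det ≠ 0 := by
  have key : ∀ {a c : ℕ} (e : a = c) (x : GL (Fin a) k) (y : GL (Fin c) k)
      (M : Matrix (Fin a) (Fin a) k),
      recast rfl e.symm (x.val * recast rfl e M * (y⁻¹).val) =
        x.val * M * ((castGL e.symm y)⁻¹).val := by
    rintro a _ rfl x y M
    rfl
  have h1 : (d.slice V).1 b = recast rfl (congrArg d.dim hc) (d.sliceValue b hc) :=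
    sliceFamily_contracted _ b hc
  rw [square, smul_apply, h1, key, Matrix.det_mul, Matrix.det_mul]
  exact mul_ne_zero (mul_ne_zero (Matrix.isUnits_det_units _).ne_zero (det_sliceValue_ne_zero b hc))
    (Matrix.isUnits_det_units _).ne_zero

theorem square_transpose (b : Q.blowup.Arrow) (hb : b.1.rev = b.1) (hc : Q.Contracted b.1)
    (W : d.blowup.srep) : (square b hc W).transpose = ((Q.sign : ℤ) : k) • square b hc W := by
  ext i j
  exact W.2 b hb j (Fin.cast (congrArg d.dim hc) i)

theorem contracted_fixed_unique {b b' : Q.blowup.Arrow} (hb : b.1.rev = b.1)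
    (hb' : b'.1.rev = b'.1) : b = b' := by
  rw [Q.blowup_fixed_iff] at hb hb'
  exact Subtype.ext (Fin.ext (hb.trans hb'.symm))

/-- Solve the equations `f_t = W_b⁻¹ f_h` along the contracted arrows, given the values at the even
vertices. -/
theorem exists_regGL_vertices {E : Type*} {B : Subalgebra k (E → k)}
    {F : ∀ w : Q.V, E → GL (Fin (d.dim w)) k} (hF : ∀ w, RegGL B (F w))
    {w : ∀ (b : Q.blowup.Arrow) (_ : Q.Contracted b.1),
      E → GL (Fin (d.dim (Q.fold (Q.blowup.head b.1)))) k} (hw : ∀ b hc, RegGL B (w b hc)) :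
    ∃ f : ∀ z : Q.blowup.V, E → GL (Fin (d.dim (Q.fold z))) k, (∀ z, RegGL B (f z)) ∧
      (∀ z, z.val % 2 = 0 → f z = F (Q.fold z)) ∧
      ∀ b hc, b.1.rev ≠ b.1 → ∀ e, f (Q.blowup.tail b.1) e =
        castGL (congrArg d.dim hc) ((w b hc e)⁻¹ * f (Q.blowup.head b.1) e) := by
  have hFcast : ∀ {v v' : Q.V} (h : v = v') (e : E), F v' e = castGL (congrArg d.dim h) (F v e) := by
    rintro v _ rfl e
    rfl
  -- If `evenDir` holds, the odd end of a contracted arrow is its head and the equation is solved as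
  -- `f_h = W_b f_t`; otherwise the odd end is the tail. An odd vertex lies on at most one
  -- contracted arrow, so the prescriptions do not conflict.
  by_cases hE : Q.evenDir = true
  · have : ∀ z : Q.blowup.V, ∃ f : E → GL (Fin (d.dim (Q.fold z))) k, RegGL B f ∧
        (z.val % 2 = 0 → f = F (Q.fold z)) ∧
        ∀ b (hc : Q.Contracted b.1), b.1.rev ≠ b.1 → ∀ hz : Q.blowup.head b.1 = z,
          f = fun e => castGL (congrArg (fun z => d.dim (Q.fold z)) hz)
            (w b hc e * F (Q.fold (Q.blowup.head b.1)) e) := by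
      intro z
      by_cases h : ∃ b : Q.blowup.Arrow, b.1.rev ≠ b.1 ∧ Q.Contracted b.1 ∧ Q.blowup.head b.1 = z
      · obtain ⟨b, hb, hc, rfl⟩ := h
        refine ⟨_, (hw b hc).mul (hF _), fun h0 => ?_, fun b' hc' hb' hz => ?_⟩
        · have := Q.head_blowup_mod b.1
          rw [if_pos hE] at this
          omega
        · obtain rfl : b' = b := Q.contracted_unique hc' hc (by rw [if_pos hE, if_pos hE, hz])
          rfl
      · exact ⟨_, hF _, fun _ => rfl, fun b hc hb hz => absurd ⟨b, hb, hc, hz⟩ h⟩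
    choose f hf hf0 hf1 using this
    refine ⟨f, hf, hf0, fun b hc hb e => ?_⟩
    have h0 := Q.tail_blowup_mod b.1
    rw [if_pos hE] at h0
    have h1 : f (Q.blowup.head b.1) e = w b hc e * F (Q.fold (Q.blowup.head b.1)) e :=
      congrFun (hf1 _ b hc hb rfl) e
    rw [hf0 _ h0, h1, inv_mul_cancel_left]
    exact hFcast hc e
  · have : ∀ z : Q.blowup.V, ∃ f : E → GL (Fin (d.dim (Q.fold z))) k, RegGL B f ∧
        (z.val % 2 = 0 → f = F (Q.fold z)) ∧
        ∀ b (hc : Q.Contracted b.1), b.1.rev ≠ b.1 → ∀ hz : Q.blowup.tail b.1 = z,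
          f = fun e => castGL ((congrArg d.dim hc).trans (congrArg (fun z => d.dim (Q.fold z)) hz))
            ((w b hc e)⁻¹ * F (Q.fold (Q.blowup.head b.1)) e) := by
      intro z
      by_cases h : ∃ b : Q.blowup.Arrow, b.1.rev ≠ b.1 ∧ Q.Contracted b.1 ∧ Q.blowup.tail b.1 = z
      · obtain ⟨b, hb, hc, rfl⟩ := h
        refine ⟨_, (((hw b hc).inv).mul (hF _)).castGL (congrArg d.dim hc), fun h0 => ?_,
          fun b' hc' hb' hz => ?_⟩
        · have := Q.tail_blowup_mod b.1
          rw [if_neg hE] at this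
          omega
        · obtain rfl : b' = b := Q.contracted_unique hc' hc (by rw [if_neg hE, if_neg hE, hz])
          rfl
      · exact ⟨_, hF _, fun _ => rfl, fun b hc hb hz => absurd ⟨b, hb, hc, hz⟩ h⟩
    choose f hf hf0 hf1 using this
    refine ⟨f, hf, hf0, fun b hc hb e => ?_⟩
    have h0 := Q.head_blowup_mod b.1
    rw [if_neg hE] at h0
    rw [hf0 _ h0, hf1 _ b hc hb rfl]

/-- An element of the group which brings a representation to the slice. -/
theorem slice_restrict_smul {W : d.blowup.srep} {g : d.blowup.G}
    (hn : ∀ b hc, b.1.rev ≠ b.1 → ∃ w : GL (Fin _) k, w.val = square b hc W ∧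
      g.1 (Q.blowup.tail b.1) = castGL (congrArg d.dim hc) (w⁻¹ * g.1 (Q.blowup.head b.1)))
    (hf : ∀ b hc, b.1.rev = b.1 → square b hc W =
      (g.1 (Q.blowup.head b.1)).val * d.sliceValue b hc *
        (g.1 (Q.blowup.head b.1)).val.transpose) :
    d.slice (d.restrict (g⁻¹ • W)) = g⁻¹ • W := by
  apply slice_restrict
  intro b hc
  rw [smul_apply, apply_eq_recast_square b hc W]
  by_cases hb : b.1.rev = b.1
  · rw [inv_apply_tail_of_fixed _ hb, hf b hc hb]
    refine (mul_recast_transpose (congrArg d.dim hc) _ _ _).trans ?_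
    congr 1
    change ((g.1 (Q.blowup.head b.1))⁻¹).val * _ * ((g.1 (Q.blowup.head b.1))⁻¹).val.transpose = _
    generalize g.1 (Q.blowup.head b.1) = x
    have h1 : x.val.transpose * (x⁻¹).val.transpose = 1 := by
      rw [← Matrix.transpose_mul, Units.inv_mul, Matrix.transpose_one]
    calc (x⁻¹).val * (x.val * d.sliceValue b hc * x.val.transpose) * (x⁻¹).val.transpose
        = ((x⁻¹).val * x.val) * d.sliceValue b hc * (x.val.transpose * (x⁻¹).val.transpose) := by
          simp only [Matrix.mul_assoc]
      _ = _ := by rw [Units.inv_mul, h1, Matrix.one_mul, Matrix.mul_one]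
  · obtain ⟨w, hw, ht⟩ := hn b hc hb
    change ((g.1 (Q.blowup.head b.1))⁻¹).val * _ * (((g.1 (Q.blowup.tail b.1))⁻¹)⁻¹).val = _
    rw [inv_inv, ht, ← hw, show d.sliceValue b hc = 1 from dif_neg hb]
    have key : ∀ {a c : ℕ} (e : a = c) (x w : GL (Fin a) k) (M : Matrix (Fin a) (Fin a) k), M = 1 →
        (x⁻¹).val * recast rfl e w.val * (castGL e (w⁻¹ * x)).val = recast rfl e M := by
      rintro a _ rfl x w _ rfl
      rw [castGL_rfl, recast_rfl, recast_rfl, ← Units.val_mul, ← Units.val_mul]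
      simp
    exact key _ _ _ _ rfl

end

universe u

variable {k : Type u} [Field k] [IsAlgClosed k] {Q : SymQuiver} {d : SymDim k Q}

/-- On a cover, the contracted arrows become invertible and the one in the middle becomes congruent
to the standard value. -/
theorem exists_cover_slice (h2 : (2 : k) ≠ 0) (g : d.blowup.G) (V : d.srep) :
    ∃ (c : Cover d.blowup.srepRing (g • d.slice V))
      (w : ∀ (b : Q.blowup.Arrow) (_ : Q.Contracted b.1),
        c.E → GL (Fin (d.dim (Q.fold (Q.blowup.head b.1)))) k)
      (F : ∀ w : Q.V, c.E → GL (Fin (d.dim w)) k),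
      (∀ b hc, RegGL c.B (w b hc) ∧ ∀ e, (w b hc e).val = square b hc (c.p e)) ∧
      (∀ v, RegGL c.B (F v)) ∧
      ∀ b hc, b.1.rev = b.1 → ∀ e, square b hc (c.p e) =
        (F (Q.fold (Q.blowup.head b.1)) e).val * d.sliceValue b hc *
          (F (Q.fold (Q.blowup.head b.1)) e).val.transpose := by
  classical
  -- One cover inverts the determinants at all contracted arrows at once.
  obtain ⟨c, hc⟩ := exists_cover_inv h2 (A := d.blowup.srepRing) (x₀ := g • d.slice V)
    (Finset.univ : Finset {b : Q.blowup.Arrow // Q.Contracted b.1})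
    (a := fun b W => (square b.1 b.2 W).det) (fun b _ => (regMatrix_square b.1 b.2).det)
    (fun b _ => det_square_ne_zero b.1 b.2 g V)
  let w : ∀ (b : Q.blowup.Arrow) (_ : Q.Contracted b.1),
      c.E → GL (Fin (d.dim (Q.fold (Q.blowup.head b.1)))) k := fun b hb e =>
    Matrix.GeneralLinearGroup.mkOfDetNeZero (square b hb (c.p e))
      ((hc ⟨b, hb⟩ (Finset.mem_univ _)).1 e)
  have hwreg : ∀ b hb, RegGL c.B (w b hb) := by
    intro b hb
    have h1 := (regMatrix_square (d := d) b hb).comp c.comap_mem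
    refine ⟨h1, ?_⟩
    have h3 := h1.inv ((hc ⟨b, hb⟩ (Finset.mem_univ _)).2)
    have h4 : (fun e => ((w b hb e)⁻¹).val) = fun e => (square b hb (c.p e))⁻¹ :=
      funext fun e => Matrix.coe_units_inv _
    rw [h4]
    exact h3
  by_cases h : ∃ b : Q.blowup.Arrow, b.1.rev = b.1 ∧ Q.Contracted b.1
  · obtain ⟨b, hb, hbc⟩ := h
    have hv : d.sliceValue b hbc = (d.Ω _ (Q.fold_fixed_of_contracted hb hbc))⁻¹ := dif_pos hb
    obtain ⟨c', γ, hγ, h3⟩ := exists_cover_congruent h2 (sign_cases (k := k) Q)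
      (A := c.B) (x₀ := c.e₀) (S := fun e => square b hbc (c.p e))
      ((regMatrix_square b hbc).comp c.comap_mem) (fun e => square_transpose b hb hbc _)
      ((hc ⟨b, hbc⟩ (Finset.mem_univ _)).1 _) (Ω := d.sliceValue b hbc)
      (by rw [hv]; exact d.Ω_inv_transpose _ _) (det_sliceValue_ne_zero b hbc)
    -- Only the fixed vertex is constrained; the other vertices get the identity.
    let F : ∀ v : Q.V, c'.E → GL (Fin (d.dim v)) k := fun v e =>
      if h : Q.fold (Q.blowup.head b.1) = v then castGL (congrArg d.dim h) (γ e) else 1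
    have hFv : F (Q.fold (Q.blowup.head b.1)) = γ := by
      funext e
      exact dif_pos rfl
    refine ⟨c.comp c', fun b' hb' e => w b' hb' (c'.p e), F,
      fun b' hb' => ⟨(hwreg b' hb').comp c'.comap_mem, fun e => rfl⟩, fun v => ?_, ?_⟩
    · by_cases hv : Q.fold (Q.blowup.head b.1) = v
      · subst hv
        rw [hFv]
        exact hγ
      · have : F v = fun _ => 1 := by
          funext e
          exact dif_neg hv
        rw [this]
        exact RegGL.const 1
    · intro b' hb' hf e
      obtain rfl := contracted_fixed_unique hb hf
      rw [hFv]
      exact h3 e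
  · exact ⟨c, w, fun _ _ => 1, fun b hb => ⟨hwreg b hb, fun e => rfl⟩, fun _ => RegGL.const 1,
      fun b hb hf => absurd ⟨b, hf, hb⟩ h⟩

/-- Over the cover, `e ↦ (g e, y e)` lifts the covering map through the action map: `g e` is the
solution of the vertex equations and `y e` is what remains of the representation after moving it to
the slice. Descent along the cover then passes to the action map. -/
theorem exists_descends (h2 : (2 : k) ≠ 0) (u : d.blowup.srep)
    (hu : u ∈ saturation d.blowup.G d.slice) :
    ∃ e : d.blowup.G × d.srep, e.1 • d.slice e.2 = u ∧
      Descends d.blowup.srepRing (prodRing d.blowup.groupRing d.srepRing)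
        (fun p : d.blowup.G × d.srep => p.1 • d.slice p.2) e := by
  obtain ⟨⟨g₀, V₀⟩, rfl⟩ := hu
  obtain ⟨c, w, F, hw, hF, hmid⟩ := exists_cover_slice h2 g₀ V₀
  obtain ⟨f, hf, hf0, hf1⟩ := exists_regGL_vertices hF (fun b hc => (hw b hc).1)
  let g : c.E → d.blowup.G := fun e =>
    d.blowup.mkG (fun z => f z e) fun z hz => absurd hz (Q.blowup_rev_ne z)
  have hgl : ∀ z, z ≤ z.rev → ∀ e, (g e).1 z = f z e := fun z hz e =>
    mkG_of_left (d := d.blowup) (hf := fun z hz => absurd hz (Q.blowup_rev_ne z)) hz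
  have hg : ∀ z, RegGL c.B (fun e => (g e).1 z) := by
    refine regGL_of_left fun z hz => ?_
    simp only [hgl z hz]
    exact hf z
  let y : c.E → d.srep := fun e => d.restrict ((g e)⁻¹ • c.p e)
  have hy : ∀ a, RegMatrix c.B (fun e => (y e).1 a) := fun a =>
    (regMatrix_smul (g := fun e => (g e)⁻¹) (fun z => (hg z).inv)
      (fun b => (regMatrix_apply b).comp c.comap_mem) (Q.lift a)).recast
      (d.dim_head_lift a).symm (d.dim_tail_lift a).symm
  have hsec : ∀ e, g e • d.slice (y e) = c.p e := by
    intro e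
    rw [slice_restrict_smul, smul_inv_smul]
    · intro b hc hb
      refine ⟨w b hc e, (hw b hc).2 e, ?_⟩
      have h1 := Q.ends_left b hb
      rw [hgl _ h1.1, hgl _ h1.2]
      exact hf1 b hc hb e
    · intro b hc hb
      have h1 := Q.head_even_of_contracted hb hc
      rw [hgl _ (Q.head_left_of_contracted hb hc), hf0 _ (by omega)]
      exact hmid b hc hb e
  -- This preimage of the point may differ from `(g₀, V₀)`; any preimage will do.
  refine ⟨(g c.e₀, y c.e₀), (hsec _).trans c.map_base, ?_⟩
  refine Descends.of_lift (s := fun e => (g e, y e)) (C := c.B) ?_ fun b hb => ?_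
  · have : (fun p : d.blowup.G × d.srep => p.1 • d.slice p.2) ∘ (fun e => (g e, y e)) = c.p :=
      funext hsec
    rw [this]
    exact c.descends
  · exact comp_mem_of_prodRing (fun a ha => comp_mem_of_groupRing hg ha)
      (fun a ha => comp_mem_of_srepRing hy ha) hb

end SymDim

end SymA

end

theorem proposition6p3 {k : Type*} [Field k] [IsAlgClosed k] (h2 : (2 : k) ≠ 0)
    (Q : SymA.SymQuiver) (d : SymA.SymDim k Q) :
    ∃ (Q' : SymA.SymQuiver) (d' : SymA.SymDim k Q') (c : SymA.Contraction Q' Q)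
      (hd : ∀ z, d'.dim z = d.dim (c.ν z)) (ι : d.G →* d'.G)
      (U : SubMulAction d'.G d'.srep)
      (hU : IsOpen[SymA.zariski d'.srepRing] (U : Set d'.srep))
      (φ : SymA.FunSpace.Iso
        ((SymA.affine d'.srepRing).openSub (U : Set d'.srep) hU)
        (SymA.bundleSpace ι d.srep d'.groupRing d.srepRing)),
      Q'.IsBipartite ∧ Even (Q'.m + 1) ∧
      SymA.IsPullback c hd ι ∧ SymA.IsClosedEmbedding d.groupRing d'.groupRing ι ∧
      ∀ (g : d'.G) (u : U), φ.toEquiv (g • u) = g • φ.toEquiv u := by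
  obtain ⟨φ, hφ⟩ := SymA.exists_bundleIso (ι := d.pullback) (σ := d.slice)
    SymA.SymDim.slice_smul SymA.SymDim.slice_injective
    (fun _ _ _ h => SymA.SymDim.mem_range_of_smul_slice h)
    (fun _ ha => SymA.SymDim.smul_slice_mem ha) (SymA.SymDim.exists_descends h2)
  exact ⟨Q.blowup, d.blowup, Q.contraction, fun _ => rfl, d.pullback, _, _, φ,
    Q.blowup_isBipartite, ⟨Q.m + 1, by change 2 * Q.m + 1 + 1 = _; omega⟩,
    SymA.SymDim.isPullback_pullback, SymA.SymDim.isClosedEmbedding_pullback, hφ⟩
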